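/- Let $\mathbb{R}_{\min}=\mathbb{R}\cup\{+\infty\}$ be the min-plus semiring, with addition $a\oplus b=\min(a,b)$ and multiplication $ab=a+b$; its zero is $+\infty$ and its unit is the real number $0$. Powers, inverses and products below are taken in this semiring. For $A\in\mathbb{R}_{\min}^{n\times n}$, let $G(A)$ be the directed graph with nodes $1,\dots,n$ and an arc $(i,j)$ whenever $A_{ij}\ne+\infty$. Call $A$ irreducible if any two nodes of $G(A)$ (equal or not) are joined by a path of length at least one; this is strong connectivity of $G(A)$, the $1\times1$ matrix $(+\infty)$ being excluded. A circuit is a closed path of length at least one, possibly with repeated nodes. For a circuit $c$, let $|c|$ be its length, $|c|_A$ the sum of the $A_{ij}$ over its arcs, and $|c|_C$ the number of its arcs whose initial node is in $C$. *Roots.* The sequence of roots of a polynomial $P=\bigoplus_{i=0}^n P_iY^i$ of degree $n$ over $\mathbb{R}_{\min}$ is the unique sequence $c_1\le\dots\le c_n$ in $\mathbb{R}_{\min}$ such that $P(y)=P_n(y\oplus c_1)\cdots(y\oplus c_n)$ for all $y\in\mathbb{R}_{\min}$. The min-plus characteristic polynomial of $A$ is the min-plus permanent $\operatorname{per}(YI\oplus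 A)$. *Critical values.* Let $\rho_{\min}(A)=\min_{1\le k\le n}\min_{i_1,\dots,i_k}(A_{i_1i_2}+\dots+A_{i_ki_1})/k$ be the minimal circuit mean. A circuit $c$ of $G(A)$ is critical if $|c|_A/|c|=\rho_{\min}(A)$, and its nodes are then called critical. For a set $C$ of indices with complement $N$ and $\lambda\in\mathbb{R}$, put $\operatorname{Schur}(C,\lambda,A)=A_{NN}\oplus A_{NC}(\lambda^{-1}A_{CC})^*\lambda^{-1}A_{CN}$, an $N\times N$ matrix, where $(B^*)_{ij}=\inf_{m\ge0}(B^m)_{ij}$. For an irreducible $A$, put $A_1=A$ and, for $\ell\ge1$, let $\alpha_\ell=\rho_{\min}(A_\ell)$, let $C_\ell$ be the set of critical nodes of $A_\ell$, let $C^\ell=C_1\cup\dots\cup C_\ell$ (with $C^0=\emptyset$), and, as long as $C^\ell\ne\{1,\dots,n\}$, let $A_{\ell+1}=\operatorname{Schur}(C_\ell,\alpha_\ell,A_\ell)$. The procedure stops at the first index $k$ with $C^k=\{1,\dots,n\}$; the numbers $\alpha_1<\dots<\alpha_k$ are the critical values of $A$, and $\alpha_\ell$ has multiplicity $|C_\ell|$.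 *Critical graphs.* For $1\le\ell\le k$, a circuit $c$ of $G(A)$ is critical of order $\ell$ if $$|c|_A-\sum_{m<\ell}\alpha_m|c|_{C_m}=\alpha_\ell\,|c|_{\{1,\dots,n\}\setminus C^{\ell-1}}$$ (in the usual arithmetic). The critical graph $G^c_\ell(A)$ consists of the nodes and arcs of the critical circuits of order $\ell$; by convention $G^c_0(A)$ is the empty graph. A graph has a disjoint circuit cover if some pairwise disjoint elementary circuits of it (circuits without repeated nodes) contain all its nodes; the empty graph has one. **Theorem.** Let $A\in\mathbb{R}_{\min}^{n\times n}$ be irreducible, let $\gamma_1\le\dots\le\gamma_n$ be the roots of its min-plus characteristic polynomial, and let $\beta_1\le\dots\le\beta_n$ be its critical values repeated with their multiplicities. For every $\ell\in\{1,\dots,k\}$, the following assertions are equivalent: 1. $\gamma_j=\beta_j$ for all $j\in\{|C^{\ell-1}|+1,\dots,|C^\ell|\}$, and $\gamma_1\cdots\gamma_{|C^{\ell-1}|}=\beta_1\cdots\beta_{|C^{\ell-1}|}$ (min-plus products, that is, usual sums); 2. both $G^c_{\ell-1}(A)$ and $G^c_\ell(A)$ have a disjoint circuit cover. -/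

import Mathlib

noncomputable section

namespace MinPlus

/-- The min-plus semiring: `ℝ ∪ {+∞}` with `min` as addition and the usual sum as
multiplication. Its zero is `+∞`, its one is the real number `0`, the inverse of a real number is
its opposite, and its order is the usual one. -/
abbrev Rmin : Type := Tropical (WithTop ℝ)

/-- The power `x ^ (1 / k)` in the min-plus semiring, that is `x / k` in the usual notation. -/
def kthRoot (k : ℕ) (x : Rmin) : Rmin :=
  Tropical.trop ((Tropical.untrop x).map fun r : ℝ => r / (k : ℝ))

/-! ### Roots of min-plus polynomials -/

/-- `c` lists the roots of (the polynomial function of) `P` in nondecreasing order, with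
multiplicities: `P(y) = P_n (y ⊕ c₁) ⋯ (y ⊕ cₙ)` for all `y`, where `n` is the degree of `P`. -/
def IsRootList (P : Polynomial Rmin) (c : List Rmin) : Prop :=
  c.length = P.natDegree ∧ c.Pairwise (· ≤ ·) ∧
    ∀ y : Rmin, P.eval y = P.leadingCoeff * (c.map fun r => y + r).prod

theorem kthRoot_pow (k : ℕ) (hk : 0 < k) (x : Rmin) : kthRoot k x ^ k = x := by
  rw [← Tropical.untrop_inj_iff, Tropical.untrop_pow]
  unfold kthRoot
  rw [Tropical.untrop_trop]
  induction Tropical.untrop x with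
  | top =>
    obtain ⟨m, rfl⟩ : ∃ m, k = m + 1 := ⟨k - 1, by omega⟩
    rw [WithTop.map_top, succ_nsmul, WithTop.add_top]
  | coe r =>
    rw [WithTop.map_coe, ← WithTop.coe_nsmul, nsmul_eq_mul]
    have : (k : ℝ) ≠ 0 := by positivity
    congr 1
    field_simp


theorem le_of_pow_le (k : ℕ) (hk : 0 < k) {x y : Rmin} (h : x ^ k ≤ y ^ k) : x ≤ y := by
  by_contra! hlt
  refine absurd h (not_le.2 ?_)
  rw [← Tropical.untrop_lt_iff] at hlt ⊢
  rw [Tropical.untrop_pow, Tropical.untrop_pow]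
  generalize Tropical.untrop x = a at hlt
  generalize Tropical.untrop y = b at hlt
  obtain ⟨b, rfl⟩ := WithTop.ne_top_iff_exists.1 (ne_top_of_lt hlt)
  induction a with
  | top =>
    obtain ⟨m, rfl⟩ : ∃ m, k = m + 1 := ⟨k - 1, by omega⟩
    rw [succ_nsmul (⊤ : WithTop ℝ), WithTop.add_top, ← WithTop.coe_nsmul]
    exact WithTop.coe_lt_top _
  | coe a =>
    rw [← WithTop.coe_nsmul, ← WithTop.coe_nsmul, WithTop.coe_lt_coe]
    exact nsmul_lt_nsmul_right hk.ne' (WithTop.coe_lt_coe.1 hlt)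

theorem pow_mono {x y : Rmin} (h : x ≤ y) (k : ℕ) : x ^ k ≤ y ^ k := pow_le_pow_left' h k

theorem mul_inv_cancel_left_of_ne {a : Rmin} (ha : a ≠ 0) (b : Rmin) : a * (a⁻¹ * b) = b := by
  rw [← mul_assoc]
  have : a * a⁻¹ = 1 := by
    rw [← Tropical.untrop_inj_iff, Tropical.untrop_mul, Tropical.untrop_inv, Tropical.untrop_one]
    have h : Tropical.untrop a ≠ ⊤ := fun h => ha (by
      rw [← Tropical.untrop_inj_iff, h, Tropical.untrop_zero])
    obtain ⟨r, hr⟩ := WithTop.ne_top_iff_exists.1 h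
    rw [← hr, ← WithTop.LinearOrderedAddCommGroup.coe_neg, ← WithTop.coe_add, add_neg_cancel]
    rfl
  rw [this, one_mul]

theorem le_of_mul_le_left {a b c : Rmin} (ha : a ≠ 0) (h : a * b ≤ a * c) : b ≤ c := by
  have := mul_le_mul_right h a⁻¹
  rwa [← mul_assoc, ← mul_assoc, mul_comm a⁻¹, mul_assoc, mul_assoc,
    mul_inv_cancel_left_of_ne ha, mul_inv_cancel_left_of_ne ha] at this

theorem add_eq_of_le {a b : Rmin} (h : a ≤ b) : a + b = a := Tropical.add_eq_left h

theorem add_sum_eq {ι : Type*} (s : Finset ι) (f : ι → Rmin) (z : Rmin)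
    (h : ∀ i ∈ s, z ≤ f i) : z + ∑ i ∈ s, f i = z := by
  classical
  induction s using Finset.induction_on with
  | empty => simp
  | insert i s hi ih =>
    rw [Finset.sum_insert hi, ← add_assoc, add_eq_of_le (h i (Finset.mem_insert_self i s))]
    exact ih fun j hj => h j (Finset.mem_insert_of_mem hj)

theorem exists_factorization (n : ℕ) : ∀ a : ℕ → Rmin, a n ≠ 0 →
    ∃ c : List Rmin, c.length = n ∧ c.Pairwise (· ≤ ·) ∧
      (∀ z : Rmin, (∀ j ≤ n, a n * z ^ (n - j) ≤ a j) → ∀ r ∈ c, z ≤ r) ∧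
      ∀ y : Rmin, ∑ j ∈ Finset.range (n + 1), a j * y ^ j =
        a n * (c.map fun r => y + r).prod := by
  induction n using Nat.strong_induction_on with
  | _ n ih =>
  intro a ha
  rcases Nat.eq_zero_or_pos n with rfl | hn
  · exact ⟨[], by simp⟩
  obtain ⟨m, hm, hmin⟩ := Finset.exists_min_image (Finset.range n)
    (fun j => kthRoot (n - j) ((a n)⁻¹ * a j)) ⟨0, by simpa using hn⟩
  rw [Finset.mem_range] at hm
  set x := kthRoot (n - m) ((a n)⁻¹ * a m) with hx
  have hxm : a n * x ^ (n - m) = a m := by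
    rw [hx, kthRoot_pow _ (by omega), mul_inv_cancel_left_of_ne ha]
  have hxj : ∀ j ≤ n, a n * x ^ (n - j) ≤ a j := by
    intro j hj
    rcases hj.lt_or_eq with hj | rfl
    · calc a n * x ^ (n - j) ≤ a n * (kthRoot (n - j) ((a n)⁻¹ * a j)) ^ (n - j) :=
            mul_le_mul_right (pow_mono (hmin j (Finset.mem_range.2 hj)) _) _
        _ = a j := by rw [kthRoot_pow _ (by omega), mul_inv_cancel_left_of_ne ha]
    · simp
  have hzx : ∀ z : Rmin, (∀ j ≤ n, a n * z ^ (n - j) ≤ a j) → z ≤ x := by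
    intro z hz
    have := hz m hm.le
    rw [← hxm] at this
    exact le_of_pow_le (n - m) (by omega) (le_of_mul_le_left ha this)
  by_cases ham : a m = 0
  · have hx0 : x = 0 := by
      rcases mul_eq_zero.1 (hxm.trans ham) with h | h
      · exact absurd h ha
      · exact pow_eq_zero_iff (by omega : n - m ≠ 0) |>.1 h
    have hj0 : ∀ j < n, a j = 0 := by
      intro j hj
      have := hxj j hj.le
      rw [hx0, zero_pow (by omega), mul_zero] at this
      exact le_antisymm (Tropical.le_zero _) this
    refine ⟨List.replicate n 0, by simp, by simp [List.pairwise_replicate], ?_, ?_⟩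
    · intro z _ r hr
      rw [List.eq_of_mem_replicate hr]
      exact Tropical.le_zero _
    · intro y
      rw [Finset.sum_range_succ, Finset.sum_eq_zero fun j hj => by
        rw [hj0 j (Finset.mem_range.1 hj), zero_mul]]
      simp
  obtain ⟨c, hc1, hc2, hc3, hc4⟩ := ih m hm a ham
  have hxc : ∀ r ∈ c, x ≤ r := by
    refine hc3 x fun j hj => ?_
    rw [← hxm, mul_assoc, ← pow_add, show n - m + (m - j) = n - j by omega]
    exact hxj j (hj.trans hm.le)
  refine ⟨List.replicate (n - m) x ++ c, by simp [hc1]; omega, ?_, ?_, ?_⟩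
  · rw [List.pairwise_append]
    refine ⟨by simp [List.pairwise_replicate], hc2, fun p hp q hq => ?_⟩
    rw [List.eq_of_mem_replicate hp]
    exact hxc q hq
  · intro z hz r hr
    rcases List.mem_append.1 hr with hr | hr
    · rw [List.eq_of_mem_replicate hr]
      exact hzx z hz
    · exact (hzx z hz).trans (hxc r hr)
  · intro y
    rw [List.map_append, List.prod_append, List.map_replicate, List.prod_replicate]
    rcases le_total y x with hy | hy
    · have h1 : (c.map fun r => y + r) = List.replicate m y := by
        rw [List.eq_replicate_iff]
        refine ⟨by simpa using hc1, fun b hb => ?_⟩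
        obtain ⟨r, hr, rfl⟩ := List.mem_map.1 hb
        exact add_eq_of_le (hy.trans (hxc r hr))
      rw [h1, List.prod_replicate, add_eq_of_le hy, ← pow_add, show n - m + m = n by omega,
        Finset.sum_range_succ, add_comm]
      refine add_sum_eq _ _ _ fun j hj => ?_
      have hj := Finset.mem_range.1 hj
      calc a n * y ^ n = a n * y ^ (n - j) * y ^ j := by
            rw [mul_assoc, ← pow_add, show n - j + j = n by omega]
        _ ≤ a n * x ^ (n - j) * y ^ j :=
            mul_le_mul_left (mul_le_mul_right (pow_mono hy _) _) _
        _ ≤ a j * y ^ j := mul_le_mul_left (hxj j hj.le) _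
    · rw [add_comm y x, add_eq_of_le hy, ← mul_assoc, hxm, ← hc4 y,
        ← Finset.sum_range_add_sum_Ico _ (show m + 1 ≤ n + 1 by omega),
        Finset.sum_range_succ, add_assoc]
      congr 1
      refine add_sum_eq _ _ _ fun j hj => ?_
      obtain ⟨h1, h2⟩ := Finset.mem_Ico.1 hj
      calc a m * y ^ m = a n * x ^ (n - j) * (x ^ (j - m) * y ^ m) := by
            rw [← hxm, mul_assoc, mul_assoc, ← mul_assoc (x ^ (n - j)), ← pow_add,
              show n - j + (j - m) = n - m by omega]
        _ ≤ a n * x ^ (n - j) * (y ^ (j - m) * y ^ m) :=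
            mul_le_mul_right (mul_le_mul_left (pow_mono hy _) _) _
        _ = a n * x ^ (n - j) * y ^ j := by
            rw [← pow_add, show j - m + m = j by omega]
        _ ≤ a j * y ^ j := mul_le_mul_left (hxj j (by omega)) _

/-- Every min-plus polynomial factors into linear factors, as a function. -/
theorem exists_isRootList (P : Polynomial Rmin) : ∃ c : List Rmin, IsRootList P c := by
  by_cases hP : P = 0
  · exact ⟨[], by simp [IsRootList, hP]⟩
  obtain ⟨c, h1, h2, -, h4⟩ := exists_factorization P.natDegree P.coeff
    (by simpa [Polynomial.coeff_natDegree] using hP)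
  exact ⟨c, h1, h2, fun y => by rw [Polynomial.eval_eq_sum_range]; exact h4 y⟩

/-- The nondecreasing list of the roots of a min-plus polynomial, with multiplicities. -/
def rootList (P : Polynomial Rmin) : List Rmin := (exists_isRootList P).choose

theorem rootList_spec (P : Polynomial Rmin) : IsRootList P (rootList P) :=
  (exists_isRootList P).choose_spec

/-! ### Directed graphs and circuits -/

/-- A directed graph whose nodes form a subset of `V`. -/
structure DirGraph (V : Type*) where
  nodes : Set V
  arc : V → V → Prop
  source_mem : ∀ i j, arc i j → i ∈ nodes
  target_mem : ∀ i j, arc i j → j ∈ nodes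

/-- A closed sequence `(i₁, …, i_k, i₁)` of elements of `V`, with `k ≥ 1`. -/
structure Circuit (V : Type*) where
  length : ℕ
  length_pos : 0 < length
  node : Fin length → V

section Circuits

variable {V : Type*}

/-- The node that follows the `j`-th node in the circuit, cyclically. -/
def Circuit.next (c : Circuit V) (j : Fin c.length) : V := c.node (finRotate c.length j)

def Circuit.support (c : Circuit V) : Set V := Set.range c.node

/-- The circuit passes through the arc `(i, j)`. -/
def Circuit.HasArc (c : Circuit V) (i j : V) : Prop := ∃ t, c.node t = i ∧ c.next t = j

/-- `c` is a circuit of the graph `G`. -/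
def Circuit.IsIn (c : Circuit V) (G : DirGraph V) : Prop := ∀ t, G.arc (c.node t) (c.next t)

/-- The circuit does not visit the same node twice. -/
def Circuit.IsElementary (c : Circuit V) : Prop := Function.Injective c.node

/-- The weight `|c|_A`: the sum, in the usual notation, of the entries `A i j` on the arcs. -/
def Circuit.weight (c : Circuit V) (A : Matrix V V Rmin) : Rmin := ∏ t, A (c.node t) (c.next t)

open Classical in
/-- The number `|c|_C` of arcs of `c` with initial node in `C`. -/
def Circuit.count (c : Circuit V) (C : Set V) : ℕ :=
  (Finset.univ.filter fun t => c.node t ∈ C).card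

/-- The graph `G` has a disjoint circuit cover: some pairwise disjoint elementary circuits of `G`
contain all the nodes of `G`. -/
def HasDisjointCircuitCover (G : DirGraph V) : Prop :=
  ∃ S : Set (Circuit V), (∀ c ∈ S, c.IsIn G ∧ c.IsElementary) ∧
    S.Pairwise (fun c d => Disjoint c.support d.support) ∧
    ∀ v ∈ G.nodes, ∃ c ∈ S, v ∈ c.support

/-- The subgraph formed by the nodes and arcs of the circuits which satisfy `p`. -/
def circuitGraph (p : Circuit V → Prop) : DirGraph V where
  nodes := {v | ∃ c, p c ∧ v ∈ c.support}
  arc i j := ∃ c, p c ∧ c.HasArc i j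
  source_mem := by
    rintro i j ⟨c, hc, t, rfl, rfl⟩
    exact ⟨c, hc, t, rfl⟩
  target_mem := by
    rintro i j ⟨c, hc, t, rfl, rfl⟩
    exact ⟨c, hc, _, rfl⟩

/-- The empty graph. -/
def emptyGraph (V : Type*) : DirGraph V where
  nodes := ∅
  arc _ _ := False
  source_mem _ _ h := h.elim
  target_mem _ _ h := h.elim

end Circuits

/-! ### Min-plus matrices -/

section Matrices

variable {V : Type*} [Fintype V] [DecidableEq V]

/-- The graph `G(A)`, with an arc `(i, j)` whenever `A i j` is finite. -/
def graph (A : Matrix V V Rmin) : DirGraph V where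
  nodes := Set.univ
  arc i j := A i j ≠ 0
  source_mem _ _ _ := trivial
  target_mem _ _ _ := trivial

/-- `G(A)` is strongly connected: any two nodes are joined by a path of length at least one.
(The positivity of the length only matters for the `1 × 1` matrix `+∞`, which is excluded.) -/
def IsIrreducible (A : Matrix V V Rmin) : Prop :=
  ∀ i j : V, Relation.TransGen (graph A).arc i j

/-- The formal characteristic polynomial `per (Y I ⊕ A)`. -/
def charPoly (A : Matrix V V Rmin) : Polynomial Rmin :=
  (Matrix.diagonal (fun _ : V => (Polynomial.X : Polynomial Rmin)) +
    A.map Polynomial.C).permanent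

/-- `ρ_min(A) = ⨁_{1 ≤ k ≤ n} ⨁_{i₁, …, i_k} (A_{i₁ i₂} ⋯ A_{i_k i₁}) ^ (1 / k)`, that is the
minimal circuit mean. -/
def rhoMin (A : Matrix V V Rmin) : Rmin :=
  ∑ k ∈ Finset.Icc 1 (Fintype.card V), ∑ i : Fin k → V,
    kthRoot k (∏ t, A (i t) (i (finRotate k t)))

/-- `c` is a critical circuit of `A`: a circuit of `G(A)` whose mean weight is `ρ_min(A)`. -/
def IsCriticalCircuit (A : Matrix V V Rmin) (c : Circuit V) : Prop :=
  c.IsIn (graph A) ∧ kthRoot c.length (c.weight A) = rhoMin A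

open Classical in
/-- The set of critical nodes of `A`, that is of nodes of critical circuits. -/
def criticalNodes (A : Matrix V V Rmin) : Finset V :=
  Finset.univ.filter fun v => ∃ c, IsCriticalCircuit A c ∧ v ∈ c.support

/-- Kleene's star, `(A^*)_{ij} = inf_{k ≥ 0} (A^k)_{ij}`. It is only used when `ρ_min(A) ≥ 0`, in
which case these infima are not `-∞`. -/
def kleeneStar (A : Matrix V V Rmin) : Matrix V V Rmin :=
  Matrix.of fun i j => ⨅ k : ℕ, (A ^ k) i j

/-- The min-plus `μ`-Schur complement `A_NN ⊕ A_NC (μ⁻¹ A_CC)^* μ⁻¹ A_CN`, where `N` is the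
complement of `C`. This `N × N` matrix is written as a `V × V` matrix, with entries `+∞` outside
`N × N`: this adds neither arcs nor circuits to its graph. -/
def schur (C : Finset V) (μ : Rmin) (A : Matrix V V Rmin) : Matrix V V Rmin :=
  Matrix.of fun i j =>
    if i ∉ C ∧ j ∉ C then
      A i j + ∑ k : C, ∑ l : C,
        A i k * kleeneStar (Matrix.of fun p q : C => μ⁻¹ * A p q) k l * (μ⁻¹ * A l j)
    else 0

/-- The matrices `A_ℓ`, for `ℓ ≥ 1`: `A_1 = A` and `A_{ℓ+1} = Schur(C_ℓ, α_ℓ, A_ℓ)`, where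
`α_ℓ = ρ_min(A_ℓ)` and `C_ℓ` is the set of critical nodes of `A_ℓ`. The value at `0` is not used.
-/
def stage (A : Matrix V V Rmin) : ℕ → Matrix V V Rmin
  | 0 => A
  | 1 => A
  | ℓ + 2 => schur (criticalNodes (stage A (ℓ + 1))) (rhoMin (stage A (ℓ + 1))) (stage A (ℓ + 1))

/-- `α_ℓ`, for `ℓ ≥ 1`. -/
def criticalValue (A : Matrix V V Rmin) (ℓ : ℕ) : Rmin := rhoMin (stage A ℓ)

/-- The set `C_ℓ`, for `ℓ ≥ 1`. -/
def criticalLayer (A : Matrix V V Rmin) (ℓ : ℕ) : Finset V := criticalNodes (stage A ℓ)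

/-- The set `C^ℓ = C_1 ∪ ⋯ ∪ C_ℓ`, with `C^0 = ∅`. -/
def criticalUnion (A : Matrix V V Rmin) (ℓ : ℕ) : Finset V :=
  (Finset.Icc 1 ℓ).biUnion (criticalLayer A)

/-- The number `k` of critical values: the first `k` such that `C^k` is the set of all nodes. -/
def numCritical (A : Matrix V V Rmin) : ℕ := sInf {ℓ | criticalUnion A ℓ = Finset.univ}

/-- `α_1, …, α_k`, where each `α_ℓ` is repeated `|C_ℓ|` times. -/
def criticalList (A : Matrix V V Rmin) : List Rmin :=
  (List.range' 1 (numCritical A)).flatMap fun ℓ =>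
    List.replicate (criticalLayer A ℓ).card (criticalValue A ℓ)

/-- `γ_j`, for `1 ≤ j ≤ n`: the `j`-th root of the characteristic polynomial of `A`. -/
def gammaSeq (A : Matrix V V Rmin) (j : ℕ) : Rmin := (rootList (charPoly A)).getD (j - 1) 0

/-- `β_j`, for `1 ≤ j ≤ n`: the `j`-th critical value of `A`, counted with multiplicities. -/
def betaSeq (A : Matrix V V Rmin) (j : ℕ) : Rmin := (criticalList A).getD (j - 1) 0

/-- `|c|_A^ℓ = |c|_A - α_1 |c|_{C_1} - ⋯ - α_{ℓ-1} |c|_{C_{ℓ-1}}`. -/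
def orderWeight (A : Matrix V V Rmin) (ℓ : ℕ) (c : Circuit V) : Rmin :=
  c.weight A * ∏ m ∈ Finset.Ico 1 ℓ, (criticalValue A m ^ c.count (criticalLayer A m))⁻¹

/-- `|c|^ℓ`, the number of arcs of `c` whose initial node is not in `C^{ℓ-1}`. -/
def orderLength (A : Matrix V V Rmin) (ℓ : ℕ) (c : Circuit V) : ℕ :=
  c.count {v | v ∉ criticalUnion A (ℓ - 1)}

/-- `c` is a critical circuit of order `ℓ ≥ 1`: a circuit of `G(A)` with
`|c|_A^ℓ = α_ℓ |c|^ℓ` (in the usual notation). -/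
def IsCriticalCircuitOfOrder (A : Matrix V V Rmin) (ℓ : ℕ) (c : Circuit V) : Prop :=
  c.IsIn (graph A) ∧ orderWeight A ℓ c = criticalValue A ℓ ^ orderLength A ℓ c

/-- The critical graph `G^c_ℓ(A)` of order `ℓ`; by convention `G^c_0(A)` is the empty graph. -/
def criticalGraph (A : Matrix V V Rmin) (ℓ : ℕ) : DirGraph V :=
  if ℓ = 0 then emptyGraph V else circuitGraph (IsCriticalCircuitOfOrder A ℓ)

end Matrices

end MinPlus

end

/-! Everything rests on one real vector `u` such that, in the usual notation, a(lev i) + u_i ≤ A_ij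
+ u_j for all i, j, where lev i is the layer of the node i and a(ℓ) = α_ℓ. Along a circuit or a
permutation the terms in `u` cancel, so the sum of the a(lev i) is a lower bound for the weight,
attained exactly when every arc used is tight, that is, gives an equality.

This vector comes out of the procedure itself (`exists_isCriticalData`). The last matrix A_k has a
potential for its minimal circuit mean, and `exists_isPotential_of_schur` extends a potential from
A_{ℓ+1} to A_ℓ. Conversely the vector found for A is a potential for every A_ℓ
(`IsPotential.schur`), and a tight arc of a Schur complement unfolds into a path of tight arcs
(`IsPotential.transGen_of_tight_schur`). Hence the critical circuits of order ℓ are the circuits of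
tight arcs inside C^ℓ, they reach every node of C^ℓ, and a disjoint circuit cover of G^c_ℓ amounts
to a permutation that follows tight arcs on C^ℓ and is the identity elsewhere.

The characteristic polynomial P detects such permutations. It satisfies P(y) ≥ ∑_v min(y, a(lev v)),
and for y strictly between α_ℓ and α_{ℓ+1} equality holds exactly when such a permutation exists.
Since P(y) = ∑_j min(y, γ_j), the cover of order ℓ exists if and only if γ and β have the same sum
over the first |C^ℓ| indices (`IsCriticalData.hasDisjointCircuitCover_iff_prod`).

So assertion 2 says that these partial sums agree at ℓ-1 and at ℓ. Assertion 1 gives this by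
addition. Conversely, the two equalities and the lower bound for P(α_ℓ) squeeze all the roots in
between to α_ℓ (`IsCriticalData.gammaSeq_eq`). -/

noncomputable section

namespace MinPlus

/-! ### Real elements of the min-plus semiring -/

/-- The real number `r` as an element of the min-plus semiring. -/
def ofReal (r : ℝ) : Rmin := Tropical.trop (r : WithTop ℝ)

theorem ofReal_ne_zero (r : ℝ) : ofReal r ≠ 0 := Tropical.trop_coe_ne_zero r

theorem exists_ofReal {x : Rmin} (hx : x ≠ 0) : ∃ r, x = ofReal r := by
  have h : Tropical.untrop x ≠ ⊤ := fun h => hx (by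
    rw [← Tropical.untrop_inj_iff, h, Tropical.untrop_zero])
  obtain ⟨r, hr⟩ := WithTop.ne_top_iff_exists.1 h
  exact ⟨r, by rw [ofReal, hr, Tropical.trop_untrop]⟩

theorem ofReal_add (a b : ℝ) : ofReal (a + b) = ofReal a * ofReal b := rfl

theorem ofReal_zero : ofReal 0 = 1 := rfl

theorem ofReal_le {a b : ℝ} : ofReal a ≤ ofReal b ↔ a ≤ b := WithTop.coe_le_coe

theorem ofReal_lt {a b : ℝ} : ofReal a < ofReal b ↔ a < b := WithTop.coe_lt_coe

theorem ofReal_inj {a b : ℝ} : ofReal a = ofReal b ↔ a = b :=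
  ⟨fun h => le_antisymm (ofReal_le.1 h.le) (ofReal_le.1 h.ge), fun h => h ▸ rfl⟩

theorem ofReal_inv (a : ℝ) : (ofReal a)⁻¹ = ofReal (-a) := rfl

theorem ofReal_pow (a : ℝ) (k : ℕ) : ofReal a ^ k = ofReal (k * a) := by
  induction k with
  | zero => simp [ofReal_zero]
  | succ k ih => rw [pow_succ, ih, ← ofReal_add]; congr 1; push_cast; ring

theorem ofReal_sum {ι : Type*} (s : Finset ι) (f : ι → ℝ) :
    ofReal (∑ i ∈ s, f i) = ∏ i ∈ s, ofReal (f i) := by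
  classical
  induction s using Finset.induction_on with
  | empty => simp [ofReal_zero]
  | insert i s hi ih => rw [Finset.sum_insert hi, Finset.prod_insert hi, ofReal_add, ih]

theorem kthRoot_ofReal (k : ℕ) (a : ℝ) : kthRoot k (ofReal a) = ofReal (a / k) := rfl

theorem mul_ofReal_le_iff {x y : Rmin} (r : ℝ) : x * ofReal r ≤ y * ofReal r ↔ x ≤ y := by
  refine ⟨fun h => ?_, fun h => mul_le_mul_left h _⟩
  rw [mul_comm x, mul_comm y] at h
  exact le_of_mul_le_left (ofReal_ne_zero r) h

theorem ofReal_mul_le_iff {x y : Rmin} (r : ℝ) : ofReal r * x ≤ ofReal r * y ↔ x ≤ y :=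
  ⟨le_of_mul_le_left (ofReal_ne_zero r), fun h => mul_le_mul_right h _⟩

theorem mul_ofReal_inj {x y : Rmin} (r : ℝ) : x * ofReal r = y * ofReal r ↔ x = y :=
  ⟨fun h => le_antisymm ((mul_ofReal_le_iff r).1 h.le) ((mul_ofReal_le_iff r).1 h.ge),
    fun h => h ▸ rfl⟩

/-! ### Min-plus sums -/

theorem sum_le {ι : Type*} {s : Finset ι} {f : ι → Rmin} {i : ι} (hi : i ∈ s) :
    ∑ j ∈ s, f j ≤ f i := by
  classical
  rw [← Finset.add_sum_erase s f hi]
  exact Tropical.add_eq_left_iff.1 (by rw [add_right_comm, Tropical.add_self])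

theorem le_sum {ι : Type*} {s : Finset ι} {f : ι → Rmin} {x : Rmin} (h : ∀ i ∈ s, x ≤ f i) :
    x ≤ ∑ j ∈ s, f j := by
  rw [← add_sum_eq s f x h]
  conv_rhs => rw [← add_zero (∑ j ∈ s, f j)]
  exact Tropical.add_eq_left_iff.1 (by
    rw [add_zero, add_assoc, Tropical.add_self])

theorem exists_sum_eq {ι : Type*} {s : Finset ι} (hs : s.Nonempty) (f : ι → Rmin) :
    ∃ i ∈ s, ∑ j ∈ s, f j = f i := by
  obtain ⟨i, hi, h⟩ := s.exists_min_image f hs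
  exact ⟨i, hi, le_antisymm (sum_le hi) (le_sum h)⟩

theorem add_le_left (x y : Rmin) : x + y ≤ x :=
  Tropical.add_eq_left_iff.1 (by rw [add_right_comm, Tropical.add_self])

theorem add_le_right (x y : Rmin) : x + y ≤ y := add_comm x y ▸ add_le_left y x

theorem le_add {x y z : Rmin} (h : x ≤ y) (h' : x ≤ z) : x ≤ y + z := le_min h h'

theorem add_eq_or (x y : Rmin) : x + y = x ∨ x + y = y := by
  rcases le_total x y with h | h
  · exact .inl (Tropical.add_eq_left h)
  · exact .inr (Tropical.add_eq_right h)

/-- With no -∞ available, the infimum in `kleeneStar` is meaningful only for a family bounded below;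
the bound will come from a potential. -/
theorem ciInf_isGLB {f : ℕ → Rmin} {b : Rmin} (hb : ∀ m, b ≤ f m) :
    IsGLB (Set.range f) (⨅ m, f m) := by
  have hB : BddBelow (Set.range fun m => Tropical.untrop (f m)) :=
    ⟨Tropical.untrop b, by rintro _ ⟨m, rfl⟩; exact hb m⟩
  have h : IsGLB (Set.range fun m => Tropical.untrop (f m))
      (sInf (Set.range fun m => Tropical.untrop (f m))) := WithTop.isGLB_sInf' hB
  have e : (⨅ m, f m) = Tropical.trop (sInf (Set.range fun m => Tropical.untrop (f m))) := by
    change Tropical.trop (sInf (Tropical.untrop '' Set.range f)) = _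
    rw [← Set.range_comp]
    rfl
  rw [e]
  constructor
  · rintro _ ⟨m, rfl⟩
    exact h.1 ⟨m, rfl⟩
  · intro c hc
    exact h.2 (by rintro _ ⟨m, rfl⟩; exact hc ⟨m, rfl⟩)

/-! ### Potentials -/

section Potentials

variable {V : Type*}

/-- `u` is a potential for `B` with node weights `w`: in the usual notation,
`w i + u i ≤ B i j + u j` for all `i, j`. -/
def IsPotential (B : Matrix V V Rmin) (w u : V → ℝ) : Prop :=
  ∀ i j, ofReal (w i + u i) ≤ B i j * ofReal (u j)

/-- The arcs for which the inequality of a potential is an equality. -/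
def Tight (B : Matrix V V Rmin) (w u : V → ℝ) (i j : V) : Prop :=
  B i j * ofReal (u j) = ofReal (w i + u i)

theorem Tight.ne_zero {B : Matrix V V Rmin} {w u : V → ℝ} {i j : V} (h : Tight B w u i j) :
    B i j ≠ 0 := by
  intro h0
  rw [Tight, h0, zero_mul] at h
  exact ofReal_ne_zero _ h.symm

theorem isPotential_iff {B : Matrix V V Rmin} {w u : V → ℝ} :
    IsPotential B w u ↔ ∀ i j, ofReal (w i + u i - u j) ≤ B i j := by
  refine forall₂_congr fun i j => ?_
  rw [← mul_ofReal_le_iff (u j) (x := ofReal (w i + u i - u j)), ← ofReal_add, sub_add_cancel]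

theorem tight_iff {B : Matrix V V Rmin} {w u : V → ℝ} {i j : V} :
    Tight B w u i j ↔ B i j = ofReal (w i + u i - u j) := by
  rw [Tight, ← mul_ofReal_inj (u j) (y := ofReal (w i + u i - u j)), ← ofReal_add, sub_add_cancel]

/-- The equality case of a termwise bound: the upper bound excludes infinite factors, and then a
real sum of nonnegative slacks is at most zero. -/
theorem eq_of_prod_le_of_le {ι : Type*} (s : Finset ι) (f : ι → ℝ) (g : ι → Rmin)
    (h : ∀ i ∈ s, ofReal (f i) ≤ g i) (h' : ∏ i ∈ s, g i ≤ ofReal (∑ i ∈ s, f i)) :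
    ∀ i ∈ s, g i = ofReal (f i) := by
  have hg : ∀ i ∈ s, g i ≠ 0 := by
    intro i hi h0
    rw [Finset.prod_eq_zero hi h0] at h'
    exact ofReal_ne_zero _ (le_antisymm (Tropical.le_zero _) h')
  choose! r hr using fun i (hi : i ∈ s) => exists_ofReal (hg i hi)
  rw [Finset.prod_congr rfl hr, ← ofReal_sum, ofReal_le] at h'
  have hle : ∀ i ∈ s, f i ≤ r i := fun i hi => ofReal_le.1 (hr i hi ▸ h i hi)
  have := (Finset.sum_eq_sum_iff_of_le hle).1 (le_antisymm (Finset.sum_le_sum hle) h')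
  intro i hi
  rw [hr i hi, this i hi]

variable {ι : Type*} [Fintype ι] {B : Matrix V V Rmin} {w u : V → ℝ}

/-- The potential cancels as soon as sources and targets have the same total. This form covers
circuits (`g` is the rotated sequence) and permutations (`f = id`) at once. -/
theorem IsPotential.le_prod (hu : IsPotential B w u) (f g : ι → V)
    (hfg : ∑ t, u (f t) = ∑ t, u (g t)) :
    ofReal (∑ t, w (f t)) ≤ ∏ t, B (f t) (g t) := by
  have : ∑ t, w (f t) = ∑ t, (w (f t) + u (f t) - u (g t)) := by
    rw [Finset.sum_sub_distrib, Finset.sum_add_distrib, hfg, add_sub_cancel_right]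
  rw [this, ofReal_sum]
  exact Finset.prod_le_prod' fun t _ => isPotential_iff.1 hu _ _

theorem prod_eq_of_tight (f g : ι → V) (hfg : ∑ t, u (f t) = ∑ t, u (g t))
    (h : ∀ t, Tight B w u (f t) (g t)) : ∏ t, B (f t) (g t) = ofReal (∑ t, w (f t)) := by
  have : ∑ t, w (f t) = ∑ t, (w (f t) + u (f t) - u (g t)) := by
    rw [Finset.sum_sub_distrib, Finset.sum_add_distrib, hfg, add_sub_cancel_right]
  rw [this, ofReal_sum]
  exact Finset.prod_congr rfl fun t _ => tight_iff.1 (h t)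

theorem IsPotential.tight_of_prod_le (hu : IsPotential B w u) (f g : ι → V)
    (hfg : ∑ t, u (f t) = ∑ t, u (g t)) (h : ∏ t, B (f t) (g t) ≤ ofReal (∑ t, w (f t))) (t : ι) :
    Tight B w u (f t) (g t) := by
  have e : ∑ t, w (f t) = ∑ t, (w (f t) + u (f t) - u (g t)) := by
    rw [Finset.sum_sub_distrib, Finset.sum_add_distrib, hfg, add_sub_cancel_right]
  rw [e] at h
  exact tight_iff.2 (eq_of_prod_le_of_le Finset.univ (fun t => w (f t) + u (f t) - u (g t))
    (fun t => B (f t) (g t)) (fun t _ => isPotential_iff.1 hu _ _) h t (Finset.mem_univ t))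

theorem Circuit.isIn_graph_iff (B : Matrix V V Rmin) (c : Circuit V) :
    c.IsIn (graph B) ↔ c.weight B ≠ 0 := by
  rw [Circuit.weight, Finset.prod_ne_zero_iff]
  simp [Circuit.IsIn, graph]

theorem Circuit.sum_next (c : Circuit V) (u : V → ℝ) :
    ∑ t, u (c.node t) = ∑ t, u (c.next t) :=
  (Equiv.sum_comp (finRotate c.length) fun t => u (c.node t)).symm

theorem IsPotential.le_weight (hu : IsPotential B w u) (c : Circuit V) :
    ofReal (∑ t, w (c.node t)) ≤ c.weight B :=
  hu.le_prod _ _ (c.sum_next u)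

theorem Circuit.weight_eq_of_tight {c : Circuit V}
    (h : ∀ t, Tight B w u (c.node t) (c.next t)) :
    c.weight B = ofReal (∑ t, w (c.node t)) :=
  prod_eq_of_tight _ _ (c.sum_next u) h

theorem IsPotential.tight_of_weight_le (hu : IsPotential B w u) {c : Circuit V}
    (h : c.weight B ≤ ofReal (∑ t, w (c.node t))) (t : Fin c.length) :
    Tight B w u (c.node t) (c.next t) :=
  hu.tight_of_prod_le _ _ (c.sum_next u) h t

end Potentials

/-! ### Circuits and transitive closures -/

section TransGen

variable {V : Type*} {r : V → V → Prop}

theorem exists_walk_of_transGen {a b : V} (h : Relation.TransGen r a b) :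
    ∃ (k : ℕ) (f : ℕ → V), 0 < k ∧ f 0 = a ∧ f k = b ∧ ∀ t < k, r (f t) (f (t + 1)) := by
  induction h using Relation.TransGen.head_induction_on with
  | @single a h =>
    exact ⟨1, fun t => if t = 0 then a else b, by simp, by simp, by simp, by simpa using h⟩
  | @head a c h _ ih =>
    obtain ⟨k, f, hk, h0, h1, h2⟩ := ih
    refine ⟨k + 1, fun t => if t = 0 then a else f (t - 1), by omega, by simp, by simpa using h1,
      fun t ht => ?_⟩
    rcases t with _ | t
    · simpa [h0] using h
    · simpa using h2 t (by omega)

/-- The circuit through the first `k` values of `f`. -/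
def circuitOfFun (k : ℕ) (hk : 0 < k) (f : ℕ → V) : Circuit V := ⟨k, hk, fun t => f t⟩

theorem circuitOfFun_next {k : ℕ} (hk : 0 < k) {f : ℕ → V} (h : f k = f 0) (t : Fin k) :
    (circuitOfFun k hk f).next t = f (t + 1) := by
  obtain ⟨k, rfl⟩ : ∃ m, k = m + 1 := ⟨k - 1, by omega⟩
  change f (finRotate (k + 1) t : ℕ) = _
  rw [coe_finRotate]
  split_ifs with ht
  · rw [ht, Fin.val_last, h]
  · rfl

theorem exists_circuit_of_transGen {a : V} (h : Relation.TransGen r a a) :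
    ∃ c : Circuit V, a ∈ c.support ∧ ∀ t, r (c.node t) (c.next t) := by
  obtain ⟨k, f, hk, h0, h1, h2⟩ := exists_walk_of_transGen h
  refine ⟨circuitOfFun k hk f, ⟨⟨0, hk⟩, h0⟩, fun t => ?_⟩
  have := circuitOfFun_next hk (h1.trans h0.symm) t
  exact this ▸ h2 t t.2

open scoped Fin.NatCast Fin.CommRing in
theorem Circuit.transGen {c : Circuit V} (h : ∀ t, r (c.node t) (c.next t)) {a : V}
    (ha : a ∈ c.support) : Relation.TransGen r a a := by
  obtain ⟨k, hk, f⟩ := c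
  obtain ⟨k, rfl⟩ : ∃ m, k = m + 1 := ⟨k - 1, by omega⟩
  obtain ⟨t, rfl⟩ := ha
  have key : ∀ s : ℕ, Relation.TransGen r (f t) (f ((finRotate (k + 1))^[s + 1] t)) := by
    intro s
    induction s with
    | zero => exact .single (h t)
    | succ s ih =>
      rw [Function.iterate_succ_apply']
      exact ih.tail (h _)
  -- Each rotation adds 1 in `Fin (k + 1)`, so `k + 1` of them lead back to the start.
  have e : (finRotate (k + 1))^[k + 1] t = t := by
    have : ∀ (m : ℕ) (i : Fin (k + 1)), (finRotate (k + 1))^[m] i = i + (m : Fin (k + 1)) := by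
      intro m i
      induction m with
      | zero => simp
      | succ m ih => rw [Function.iterate_succ_apply', ih, finRotate_apply]; push_cast; ring
    exact (this (k + 1) t).trans (by simp)
  have := key k
  rwa [e] at this

end TransGen

/-! ### Existence of potentials -/

section Existence

variable {V : Type*} [Fintype V]

/-- The minimal weight of the walks of length `m` that start at a given node. -/
def walkMin (M : Matrix V V Rmin) : ℕ → V → Rmin
  | 0, _ => 1
  | m + 1, i => ∑ j, M i j * walkMin M m j

theorem walkMin_le (M : Matrix V V Rmin) (k : ℕ) (w : ℕ → V) :
    walkMin M k (w 0) ≤ ∏ t ∈ Finset.range k, M (w t) (w (t + 1)) := by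
  induction k generalizing w with
  | zero => simp [walkMin]
  | succ k ih =>
    rw [Finset.prod_range_succ', mul_comm]
    exact (sum_le (Finset.mem_univ (w 1))).trans (mul_le_mul_right (ih fun t => w (t + 1)) _)

theorem exists_walkMin_eq (M : Matrix V V Rmin) (k : ℕ) (i : V) :
    ∃ w : ℕ → V, w 0 = i ∧ walkMin M k i = ∏ t ∈ Finset.range k, M (w t) (w (t + 1)) := by
  induction k generalizing i with
  | zero => exact ⟨fun _ => i, by simp [walkMin]⟩
  | succ k ih =>
    obtain ⟨j, -, hj⟩ := exists_sum_eq ⟨i, Finset.mem_univ i⟩ fun j => M i j * walkMin M k j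
    obtain ⟨w, h0, hw⟩ := ih j
    refine ⟨fun t => if t = 0 then i else w (t - 1), by simp, ?_⟩
    rw [Finset.prod_range_succ', mul_comm]
    simp only [Nat.add_eq_zero_iff, one_ne_zero, and_false, if_false, Nat.add_sub_cancel, if_true,
      h0, ← hw]
    exact hj.trans (by simp)

theorem rhoMin_le_kthRoot (B : Matrix V V Rmin) (c : Circuit V)
    (hc : c.length ≤ Fintype.card V) : rhoMin B ≤ kthRoot c.length (c.weight B) :=
  (sum_le (Finset.mem_Icc.2 ⟨c.length_pos, hc⟩)).trans (sum_le (Finset.mem_univ c.node))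

theorem ofReal_le_kthRoot_iff {k : ℕ} (hk : 0 < k) {a : ℝ} {x : Rmin} :
    ofReal a ≤ kthRoot k x ↔ ofReal (k * a) ≤ x := by
  rw [← ofReal_pow]
  constructor
  · intro h
    simpa only [kthRoot_pow k hk] using pow_mono h k
  · intro h
    exact le_of_pow_le k hk (by rwa [kthRoot_pow k hk])

/-- `rhoMin` only takes account of circuits of length at most `Fintype.card V`, whence the bound on
`b - a`; the pigeonhole principle produces such short cycles. -/
theorem one_le_cycle (B : Matrix V V Rmin) {α : ℝ} (hα : ofReal α ≤ rhoMin B) (w : ℕ → V)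
    {a b : ℕ} (hab : a < b) (hb : b - a ≤ Fintype.card V) (h : w a = w b) :
    1 ≤ ∏ t ∈ Finset.Ico a b, ofReal (-α) * B (w t) (w (t + 1)) := by
  set c : Circuit V := circuitOfFun (b - a) (by omega) fun t => w (a + t)
  have h1 : ofReal ((b - a : ℕ) * α) ≤ c.weight B :=
    (ofReal_le_kthRoot_iff c.length_pos).1 (hα.trans (rhoMin_le_kthRoot B c hb))
  have h2 : c.weight B = ∏ t ∈ Finset.range (b - a), B (w (a + t)) (w (a + t + 1)) := by
    rw [← Fin.prod_univ_eq_prod_range (fun t => B (w (a + t)) (w (a + t + 1)))]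
    refine Finset.prod_congr rfl fun t _ => ?_
    exact congrArg _ (circuitOfFun_next _ (by
      change w (a + (b - a)) = w a
      rw [Nat.add_sub_cancel' hab.le, h]) t)
  rw [Finset.prod_mul_distrib, Finset.prod_const, Nat.card_Ico, Finset.prod_Ico_eq_prod_range,
    ← h2, ofReal_pow, ← ofReal_mul_le_iff ((b - a : ℕ) * α), ← mul_assoc, ← ofReal_add]
  simpa [ofReal_zero] using h1

/-- A walk with as many arcs as there are nodes repeats a node, and the cycle in between has
nonnegative scaled weight, so cutting it out does not increase the weight. -/
theorem exists_walkMin_le (B : Matrix V V Rmin) {α : ℝ} (hα : ofReal α ≤ rhoMin B) (i : V) :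
    ∃ m < Fintype.card V, walkMin (fun p q => ofReal (-α) * B p q) m i ≤
      walkMin (fun p q => ofReal (-α) * B p q) (Fintype.card V) i := by
  set n := Fintype.card V with hn
  set M : Matrix V V Rmin := fun p q => ofReal (-α) * B p q with hM
  obtain ⟨w, rfl, hw⟩ := exists_walkMin_eq M n i
  obtain ⟨a, b, hab, hbn, h⟩ : ∃ a b, a < b ∧ b ≤ n ∧ w a = w b := by
    obtain ⟨a, b, hne, h⟩ := Fintype.exists_ne_map_eq_of_card_lt
      (fun t : Fin (n + 1) => w t) (by simp [hn])
    rcases lt_or_gt_of_ne hne with hlt | hlt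
    · exact ⟨a, b, hlt, by omega, h⟩
    · exact ⟨b, a, hlt, by omega, h.symm⟩
  have hcyc : 1 ≤ ∏ t ∈ Finset.Ico a b, M (w t) (w (t + 1)) :=
    one_le_cycle B hα w hab (by omega) h
  refine ⟨a + (n - b), by omega, ?_⟩
  rw [hw]
  -- The walk `w` without the cycle from time `a` to time `b`; the two pieces fit because `w a = w
  -- b`.
  set v : ℕ → V := fun t => if t ≤ a then w t else w (t + (b - a)) with hv
  have hv0 : v 0 = w 0 := by simp [hv]
  rw [← hv0]
  refine (walkMin_le M _ v).trans ?_
  have e1 : ∏ t ∈ Finset.range (a + (n - b)), M (v t) (v (t + 1)) =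
      (∏ t ∈ Finset.range a, M (w t) (w (t + 1))) *
        ∏ t ∈ Finset.Ico b n, M (w t) (w (t + 1)) := by
    rw [Finset.prod_range_add, Finset.prod_Ico_eq_prod_range]
    congr 1
    · refine Finset.prod_congr rfl fun t ht => ?_
      have := Finset.mem_range.1 ht
      simp only [hv]
      rw [if_pos (by omega), if_pos (by omega)]
    · refine Finset.prod_congr rfl fun t ht => ?_
      have e2 : v (a + t) = w (b + t) := by
        simp only [hv]
        split_ifs with h'
        · obtain rfl : t = 0 := by omega
          simpa using h
        · congr 1; omega
      have e3 : v (a + t + 1) = w (b + t + 1) := by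
        simp only [hv]
        rw [if_neg (by omega)]
        congr 1; omega
      rw [e2, e3]
  rw [e1, Finset.range_eq_Ico, Finset.range_eq_Ico,
    ← Finset.prod_Ico_consecutive _ (Nat.zero_le a) (hab.le.trans hbn),
    ← Finset.prod_Ico_consecutive _ hab.le hbn]
  refine mul_le_mul_right ?_ _
  conv_lhs => rw [← one_mul (∏ t ∈ Finset.Ico b n, M (w t) (w (t + 1)))]
  exact mul_le_mul_left hcyc _

/-- A real number which is at most the minimal circuit mean has a potential. -/
theorem exists_isPotential (B : Matrix V V Rmin) {α : ℝ} (hα : ofReal α ≤ rhoMin B) :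
    ∃ x : V → ℝ, IsPotential B (fun _ => α) x := by
  rcases isEmpty_or_nonempty V with hV | hV
  · exact ⟨fun _ => 0, fun i => hV.elim i⟩
  set n := Fintype.card V with hn
  have hn0 : 0 < n := Fintype.card_pos
  set M : Matrix V V Rmin := fun p q => ofReal (-α) * B p q with hM
  -- The potential is the least scaled weight of a walk of length less than `n`; the walk of length
  -- 0 keeps it finite.
  have hx : ∀ i, ∃ r, ∑ m ∈ Finset.range n, walkMin M m i = ofReal r := by
    intro i
    refine exists_ofReal fun h0 => ?_
    have := sum_le (f := fun m => walkMin M m i) (Finset.mem_range.2 hn0)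
    rw [h0] at this
    exact ofReal_ne_zero 0 (le_antisymm (Tropical.le_zero _) this)
  choose x hx using hx
  refine ⟨x, fun i j => ?_⟩
  have key : ∑ m ∈ Finset.range n, walkMin M m i ≤
      M i j * ∑ m ∈ Finset.range n, walkMin M m j := by
    obtain ⟨m, hm, h⟩ := exists_sum_eq (Finset.nonempty_range_iff.2 hn0.ne')
      fun m => walkMin M m j
    rw [h]
    have h1 : walkMin M (m + 1) i ≤ M i j * walkMin M m j := sum_le (Finset.mem_univ j)
    refine le_trans ?_ h1
    rcases (Nat.succ_le_of_lt (Finset.mem_range.1 hm)).lt_or_eq with h2 | h2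
    · exact sum_le (f := fun m => walkMin M m i) (Finset.mem_range.2 h2)
    -- Putting an arc in front may produce length exactly `n`, which some shorter length does at
    -- least as well.
    · obtain ⟨m', hm', h3⟩ := exists_walkMin_le B hα i
      have h2' : m + 1 = Fintype.card V := h2
      rw [h2']
      exact (sum_le (f := fun m => walkMin M m i) (Finset.mem_range.2 hm')).trans h3
  rw [hx, hx, hM, ← ofReal_mul_le_iff α, ← mul_assoc, ← mul_assoc, ← ofReal_add, ← ofReal_add,
    add_neg_cancel, ofReal_zero, one_mul] at key
  exact key

/-- The circuit may be longer than `Fintype.card V`, so the definition of `rhoMin` does not see it.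
But if `rhoMin B` were +∞, every real number would have a potential and would bound the mean of `c`
from below. -/
theorem rhoMin_ne_zero {B : Matrix V V Rmin} {c : Circuit V} (hc : c.IsIn (graph B)) :
    rhoMin B ≠ 0 := by
  intro h0
  obtain ⟨r, hr⟩ := exists_ofReal ((Circuit.isIn_graph_iff B c).1 hc)
  obtain ⟨x, hx⟩ := exists_isPotential B (α := |r| + 1) (h0 ▸ Tropical.le_zero _)
  have h := hx.le_weight c
  rw [hr, ofReal_le, Finset.sum_const, Finset.card_univ, Fintype.card_fin, nsmul_eq_mul] at h
  have h1 : (1 : ℝ) ≤ c.length := by exact_mod_cast c.length_pos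
  nlinarith [le_abs_self r, abs_nonneg r]

theorem isCriticalCircuit_iff {B : Matrix V V Rmin} {α : ℝ} (hα : rhoMin B = ofReal α)
    (c : Circuit V) : IsCriticalCircuit B c ↔ c.weight B = ofReal (c.length * α) := by
  rw [IsCriticalCircuit, Circuit.isIn_graph_iff, hα, ← ofReal_pow]
  constructor
  · rintro ⟨-, h⟩
    rw [← h, kthRoot_pow _ c.length_pos]
  · intro h
    rw [h, ofReal_pow, kthRoot_ofReal]
    refine ⟨ofReal_ne_zero _, ?_⟩
    have : (c.length : ℝ) ≠ 0 := by exact_mod_cast c.length_pos.ne'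
    congr 1
    field_simp

theorem exists_isCriticalCircuit {B : Matrix V V Rmin} (h0 : rhoMin B ≠ 0) :
    ∃ c, IsCriticalCircuit B c := by
  obtain ⟨α, hα⟩ := exists_ofReal h0
  have hne : (Finset.Icc 1 (Fintype.card V)).Nonempty := by
    rw [Finset.nonempty_iff_ne_empty]
    intro h
    rw [rhoMin, h, Finset.sum_empty] at h0
    exact h0 rfl
  obtain ⟨k, hk, h⟩ := exists_sum_eq hne fun k => ∑ i : Fin k → V,
    kthRoot k (∏ t, B (i t) (i (finRotate k t)))
  have hk := Finset.mem_Icc.1 hk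
  have hV : Nonempty V := Fintype.card_pos_iff.1 (by omega)
  obtain ⟨f, -, hf⟩ := exists_sum_eq (Finset.univ_nonempty (α := Fin k → V)) fun i =>
    kthRoot k (∏ t, B (i t) (i (finRotate k t)))
  refine ⟨⟨k, hk.1, f⟩, (isCriticalCircuit_iff hα _).2 ?_⟩
  have h1 : rhoMin B = kthRoot k (Circuit.weight ⟨k, hk.1, f⟩ B) := h.trans hf
  rw [← ofReal_pow, ← hα, h1, kthRoot_pow k hk.1]

theorem mem_criticalNodes {B : Matrix V V Rmin} {v : V} :
    v ∈ criticalNodes B ↔ ∃ c, IsCriticalCircuit B c ∧ v ∈ c.support := by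
  simp [criticalNodes]

end Existence

theorem ne_zero_of_le {x y : Rmin} (h : x ≤ y) (hy : y ≠ 0) : x ≠ 0 := by
  rintro rfl
  exact hy (le_antisymm (Tropical.le_zero _) h)

theorem eq_ofReal_of_mul_le {a b : Rmin} {r s : ℝ} (ha : ofReal r ≤ a) (hb : ofReal s ≤ b)
    (h : a * b ≤ ofReal (r + s)) : a = ofReal r ∧ b = ofReal s := by
  constructor
  · refine le_antisymm ((mul_ofReal_le_iff s).1 ?_) ha
    exact (mul_le_mul_right hb a).trans h
  · refine le_antisymm ((ofReal_mul_le_iff r).1 ?_) hb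
    exact (mul_le_mul_left ha b).trans h

theorem exists_sum_eq_of_ne_zero {ι : Type*} {s : Finset ι} {f : ι → Rmin}
    (h : ∑ j ∈ s, f j ≠ 0) : ∃ i ∈ s, ∑ j ∈ s, f j = f i := by
  refine exists_sum_eq ?_ f
  rw [Finset.nonempty_iff_ne_empty]
  rintro rfl
  exact h Finset.sum_empty

/-! ### Kleene stars -/

/-- By finiteness, one positive slack works for all arcs that are not tight. It is needed because a
Kleene star is an infimum over infinitely many powers. -/
theorem exists_gap {W : Type*} [Finite W] {M : Matrix W W Rmin} {x : W → ℝ}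
    (hx : IsPotential M (fun _ => 0) x) :
    ∃ ε > 0, ∀ p q, Tight M (fun _ => 0) x p q ∨ ofReal (x p - x q + ε) ≤ M p q := by
  have h : ∀ pq : W × W, ∃ ε > 0, Tight M (fun _ => 0) x pq.1 pq.2 ∨
      ofReal (x pq.1 - x pq.2 + ε) ≤ M pq.1 pq.2 := by
    rintro ⟨p, q⟩
    by_cases h0 : M p q = 0
    · exact ⟨1, one_pos, .inr (h0 ▸ Tropical.le_zero _)⟩
    obtain ⟨r, hr⟩ := exists_ofReal h0
    have h1 := isPotential_iff.1 hx p q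
    rw [hr, ofReal_le] at h1
    rcases h1.lt_or_eq with h1 | h1
    · refine ⟨r - (x p - x q), by linarith, .inr ?_⟩
      dsimp only
      rw [hr, ofReal_le]
      linarith
    · exact ⟨1, one_pos, .inl (tight_iff.2 (by rw [hr, h1]))⟩
  choose ε hε h using h
  obtain ⟨δ, hδ, hle⟩ : ∃ δ > 0, ∀ pq, δ ≤ ε pq := by
    rcases isEmpty_or_nonempty (W × W) with hW | hW
    · exact ⟨1, one_pos, fun pq => hW.elim pq⟩
    · obtain ⟨a, ha⟩ := Finite.exists_min ε
      exact ⟨ε a, hε a, ha⟩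
  refine ⟨δ, hδ, fun p q => (h (p, q)).imp_right fun h => (ofReal_le.2 ?_).trans h⟩
  have := hle (p, q)
  dsimp only
  linarith

section Star

variable {W : Type*} [Fintype W] [DecidableEq W] {M : Matrix W W Rmin} {x : W → ℝ}

theorem IsPotential.le_pow (hx : IsPotential M (fun _ => 0) x) (m : ℕ) (p l : W) :
    ofReal (x p - x l) ≤ (M ^ m) p l := by
  induction m generalizing p with
  | zero =>
    rw [pow_zero, Matrix.one_apply]
    split_ifs with h
    · subst h
      rw [sub_self, ofReal_zero]
    · exact Tropical.le_zero _
  | succ m ih =>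
    rw [pow_succ', Matrix.mul_apply]
    refine le_sum fun q _ => ?_
    have h := mul_le_mul' (isPotential_iff.1 hx p q) (ih q)
    rw [← ofReal_add] at h
    exact (ofReal_le.2 (by linarith)).trans h

theorem IsPotential.isGLB_kleeneStar (hx : IsPotential M (fun _ => 0) x) (p l : W) :
    IsGLB (Set.range fun m => (M ^ m) p l) (kleeneStar M p l) :=
  ciInf_isGLB fun m => hx.le_pow m p l

theorem IsPotential.kleeneStar_le_pow (hx : IsPotential M (fun _ => 0) x) (p l : W) (m : ℕ) :
    kleeneStar M p l ≤ (M ^ m) p l :=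
  (hx.isGLB_kleeneStar p l).1 ⟨m, rfl⟩

theorem IsPotential.le_kleeneStar (hx : IsPotential M (fun _ => 0) x) {p l : W} {b : Rmin}
    (h : ∀ m, b ≤ (M ^ m) p l) : b ≤ kleeneStar M p l :=
  (hx.isGLB_kleeneStar p l).2 (by rintro _ ⟨m, rfl⟩; exact h m)

theorem IsPotential.kleeneStar_self_le (hx : IsPotential M (fun _ => 0) x) (p : W) :
    kleeneStar M p p ≤ 1 := by
  simpa using hx.kleeneStar_le_pow p p 0

theorem IsPotential.kleeneStar_le_mul (hx : IsPotential M (fun _ => 0) x) (p q l : W) :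
    kleeneStar M p l ≤ M p q * kleeneStar M q l := by
  by_cases h0 : M p q = 0
  · rw [h0, zero_mul]
    exact Tropical.le_zero _
  obtain ⟨r, hr⟩ := exists_ofReal h0
  -- Dividing by the finite entry `M p q` moves it to the other side, so that the infimum on the
  -- right can be bounded power by power.
  have : ofReal (-r) * kleeneStar M p l ≤ kleeneStar M q l := by
    refine hx.le_kleeneStar fun m => ?_
    rw [← ofReal_mul_le_iff r, ← mul_assoc, ← ofReal_add, add_neg_cancel, ofReal_zero, one_mul]
    refine (hx.kleeneStar_le_pow p l (m + 1)).trans ?_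
    rw [pow_succ', Matrix.mul_apply, ← hr]
    exact sum_le (Finset.mem_univ q)
  rw [← ofReal_mul_le_iff r, ← mul_assoc, ← ofReal_add, add_neg_cancel, ofReal_zero,
    one_mul] at this
  rwa [hr]

/-- If no tight path joins `p` to `l`, every walk between them uses an arc that is not tight and
exceeds `x p - x l` by the uniform gap; so does the infimum. -/
theorem IsPotential.reflTransGen_tight (hx : IsPotential M (fun _ => 0) x) {p l : W}
    (h : kleeneStar M p l = ofReal (x p - x l)) :
    Relation.ReflTransGen (Tight M (fun _ => 0) x) p l := by
  obtain ⟨ε, hε, hgap⟩ := exists_gap hx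
  have key : ∀ (m : ℕ) (p : W), Relation.ReflTransGen (Tight M (fun _ => 0) x) p l ∨
      ofReal (x p - x l + ε) ≤ (M ^ m) p l := by
    intro m
    induction m with
    | zero =>
      intro p
      by_cases hpl : p = l
      · exact .inl (hpl ▸ .refl)
      · right
        rw [pow_zero, Matrix.one_apply_ne hpl]
        exact Tropical.le_zero _
    | succ m ih =>
      intro p
      by_cases hp : Relation.ReflTransGen (Tight M (fun _ => 0) x) p l
      · exact .inl hp
      right
      rw [pow_succ', Matrix.mul_apply]
      refine le_sum fun q _ => ?_
      rcases hgap p q with h1 | h1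
      · rcases ih q with h2 | h2
        · exact absurd (h2.head h1) hp
        · have h := mul_le_mul' (isPotential_iff.1 hx p q) h2
          rw [← ofReal_add] at h
          exact (ofReal_le.2 (by linarith)).trans h
      · have h := mul_le_mul' h1 (hx.le_pow m q l)
        rw [← ofReal_add] at h
        exact (ofReal_le.2 (by linarith)).trans h
  by_contra hp
  have h1 : ofReal (x p - x l + ε) ≤ kleeneStar M p l :=
    hx.le_kleeneStar fun m => (key m p).resolve_left hp
  rw [h, ofReal_le] at h1
  linarith

end Star

/-! ### Schur complements -/

section Schur

variable {V : Type*} {C : Finset V} {α : ℝ} {B : Matrix V V Rmin} {w u : V → ℝ}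

theorem IsPotential.scaled_le (hu : IsPotential B w u) {p : V} (hp : w p = α) (q : V) :
    ofReal (u p - u q) ≤ (ofReal α)⁻¹ * B p q := by
  rw [ofReal_inv, ← ofReal_mul_le_iff α, ← mul_assoc, ← ofReal_add, ← ofReal_add, add_neg_cancel,
    ofReal_zero, one_mul, ← hp]
  convert isPotential_iff.1 hu p q using 2
  ring

theorem tight_iff_scaled {p q : V} (hp : w p = α) :
    Tight B w u p q ↔ (ofReal α)⁻¹ * B p q = ofReal (u p - u q) := by
  rw [tight_iff, hp, ofReal_inv, show α + u p - u q = α + (u p - u q) by ring, ofReal_add]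
  constructor
  · intro h
    rw [h, ← mul_assoc, ← ofReal_add, neg_add_cancel, ofReal_zero, one_mul]
  · intro h
    rw [← h, ← mul_assoc, ← ofReal_add, add_neg_cancel, ofReal_zero, one_mul]

/-- The matrix `α⁻¹ B_CC`. -/
def scaledBlock (C : Finset V) (α : ℝ) (B : Matrix V V Rmin) : Matrix C C Rmin :=
  Matrix.of fun p q : C => (ofReal α)⁻¹ * B p q

theorem IsPotential.scaledBlock (hu : IsPotential B w u) (hw : ∀ p ∈ C, w p = α) :
    IsPotential (scaledBlock C α B) (fun _ => 0) fun p => u p := by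
  refine isPotential_iff.2 fun p q => ?_
  rw [zero_add]
  exact hu.scaled_le (hw p p.2) q

variable [DecidableEq V]

theorem schur_apply {i j : V} (hi : i ∉ C) (hj : j ∉ C) :
    schur C (ofReal α) B i j = B i j + ∑ k : C, ∑ l : C,
      B i k * kleeneStar (scaledBlock C α B) k l * ((ofReal α)⁻¹ * B l j) := by
  simp [schur, hi, hj, scaledBlock]

theorem schur_eq_zero {i j : V} {μ : Rmin} (h : i ∈ C ∨ j ∈ C) : schur C μ B i j = 0 := by
  rw [schur, Matrix.of_apply, if_neg (by tauto)]

theorem schur_le {i j : V} (hi : i ∉ C) (hj : j ∉ C) : schur C (ofReal α) B i j ≤ B i j := by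
  rw [schur_apply hi hj]
  exact add_le_left _ _

theorem schur_le_mul {i j : V} (hi : i ∉ C) (hj : j ∉ C) (k l : C) :
    schur C (ofReal α) B i j ≤
      B i k * kleeneStar (scaledBlock C α B) k l * ((ofReal α)⁻¹ * B l j) := by
  rw [schur_apply hi hj]
  exact (add_le_right _ _).trans ((sum_le (Finset.mem_univ k)).trans (sum_le (Finset.mem_univ l)))

theorem IsPotential.le_kleeneStar_scaledBlock (hu : IsPotential B w u) (hw : ∀ p ∈ C, w p = α)
    (k l : C) : ofReal (u k - u l) ≤ kleeneStar (MinPlus.scaledBlock C α B) k l :=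
  (hu.scaledBlock hw).le_kleeneStar fun m => (hu.scaledBlock hw).le_pow m k l

/-- A potential for `B` is a potential for its Schur complements. -/
theorem IsPotential.schur (hu : IsPotential B w u) (hw : ∀ p ∈ C, w p = α) :
    IsPotential (schur C (ofReal α) B) w u := by
  refine isPotential_iff.2 fun i j => ?_
  by_cases h : i ∈ C ∨ j ∈ C
  · rw [schur_eq_zero h]
    exact Tropical.le_zero _
  push Not at h
  rw [schur_apply h.1 h.2]
  refine le_add (isPotential_iff.1 hu i j) (le_sum fun k _ => le_sum fun l _ => ?_)
  have := mul_le_mul' (mul_le_mul' (isPotential_iff.1 hu i k)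
    (hu.le_kleeneStar_scaledBlock hw k l)) (hu.scaled_le (hw l l.2) j)
  rw [← ofReal_add, ← ofReal_add] at this
  exact (ofReal_le.2 (by linarith)).trans this

/-- A tight arc of the Schur complement comes from a path of tight arcs through `C`. -/
theorem IsPotential.transGen_of_tight_schur (hu : IsPotential B w u) (hw : ∀ p ∈ C, w p = α)
    {i j : V} (h : Tight (MinPlus.schur C (ofReal α) B) w u i j) :
    i ∉ C ∧ j ∉ C ∧ Relation.TransGen
      (fun a b => Tight B w u a b ∧ (a = i ∨ a ∈ C) ∧ (b = j ∨ b ∈ C)) i j := by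
  have hij : ¬ (i ∈ C ∨ j ∈ C) := fun h' => h.ne_zero (schur_eq_zero h')
  push Not at hij
  refine ⟨hij.1, hij.2, ?_⟩
  have h' := tight_iff.1 h
  rw [schur_apply hij.1 hij.2] at h'
  set S := ∑ k : C, ∑ l : C,
    B i k * kleeneStar (MinPlus.scaledBlock C α B) k l * ((ofReal α)⁻¹ * B l j) with hS
  rcases add_eq_or (B i j) S with h1 | h1
  · rw [h1] at h'
    exact .single ⟨tight_iff.2 h', .inl rfl, .inl rfl⟩
  rw [h1] at h'
  have hS0 : S ≠ 0 := h' ▸ ofReal_ne_zero _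
  obtain ⟨k, -, hk⟩ := exists_sum_eq_of_ne_zero hS0
  rw [← hS] at hk
  rw [hk] at hS0
  obtain ⟨l, -, hl⟩ := exists_sum_eq_of_ne_zero hS0
  rw [hk, hl] at h'
  -- The potential bounds the three factors from below, and these bounds multiply to the actual
  -- value; hence each of them is attained.
  have b1 := isPotential_iff.1 hu i k
  have b2 := hu.le_kleeneStar_scaledBlock hw k l
  have b3 := hu.scaled_le (hw l l.2) j
  have b12 := mul_le_mul' b1 b2
  rw [← ofReal_add] at b12
  obtain ⟨e12, e3⟩ := eq_ofReal_of_mul_le b12 b3 (h'.le.trans (ofReal_le.2 (by linarith)))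
  obtain ⟨e1, e2⟩ := eq_ofReal_of_mul_le b1 b2 e12.le
  have hkl := (hu.scaledBlock hw).reflTransGen_tight e2
  have hkl' : Relation.ReflTransGen
      (fun a b => Tight B w u a b ∧ (a = i ∨ a ∈ C) ∧ (b = j ∨ b ∈ C)) (k : V) (l : V) := by
    refine hkl.lift _ fun p q hpq => ⟨(tight_iff_scaled (hw p p.2)).2 ?_, .inr p.2, .inr q.2⟩
    have := tight_iff.1 hpq
    rw [zero_add] at this
    exact this
  exact Relation.TransGen.tail' (hkl'.head ⟨tight_iff.2 e1, .inl rfl, .inr k.2⟩)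
    ⟨(tight_iff_scaled (hw l l.2)).2 e3, .inr l.2, .inl rfl⟩

/-- Strong connectivity passes to Schur complements. -/
theorem transGen_schur {x : V → ℝ} (hx : IsPotential B (fun _ => α) x) {i j : V} (hi : i ∉ C)
    (hj : j ∉ C) (h : Relation.TransGen (fun a b => B a b ≠ 0) i j) :
    Relation.TransGen (fun a b => schur C (ofReal α) B a b ≠ 0) i j := by
  have hM := hx.scaledBlock (C := C) fun _ _ => rfl
  -- Follow the walk. While it is inside `C`, remember the last node `a` outside `C`, the entry
  -- point `p`, and a finite power entry from `p` to the current node; on leaving `C` these combine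
  -- into one arc of the Schur complement.
  suffices H : ∀ y, Relation.TransGen (fun a b => B a b ≠ 0) i y →
      (y ∉ C → Relation.TransGen (fun a b => schur C (ofReal α) B a b ≠ 0) i y) ∧
      ∀ hy : y ∈ C, ∃ a ∉ C, Relation.ReflTransGen (fun a b => schur C (ofReal α) B a b ≠ 0) i a ∧
        ∃ p : C, B a p ≠ 0 ∧ ∃ m, (scaledBlock C α B ^ m) p ⟨y, hy⟩ ≠ 0 from (H j h).1 hj
  intro y hy
  induction hy with
  | @single y h =>
    exact ⟨fun hy => .single (ne_zero_of_le (schur_le hi hy) h),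
      fun hy => ⟨i, hi, .refl, ⟨y, hy⟩, h, 0, by
        rw [pow_zero, Matrix.one_apply_eq]; exact ofReal_ne_zero 0⟩⟩
  | @tail y z _ h ih =>
    by_cases hy : y ∈ C
    · obtain ⟨a, ha, h1, p, h2, m, h3⟩ := ih.2 hy
      have h4 : (ofReal α)⁻¹ * B y z ≠ 0 := mul_ne_zero (ofReal_ne_zero (-α)) h
      refine ⟨fun hz => Relation.TransGen.tail' h1 (ne_zero_of_le (schur_le_mul ha hz p ⟨y, hy⟩) ?_),
        fun hz => ⟨a, ha, h1, p, h2, m + 1,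
          ne_zero_of_le (y := (scaledBlock C α B ^ m) p ⟨y, hy⟩ * ((ofReal α)⁻¹ * B y z)) ?_
            (mul_ne_zero h3 h4)⟩⟩
      · exact mul_ne_zero (mul_ne_zero h2 (ne_zero_of_le (hM.kleeneStar_le_pow _ _ m) h3)) h4
      · rw [pow_succ, Matrix.mul_apply]
        exact sum_le (f := fun q => (scaledBlock C α B ^ m) p q * scaledBlock C α B q ⟨z, hz⟩)
          (Finset.mem_univ (⟨y, hy⟩ : C))
    · have h1 := ih.1 hy
      exact ⟨fun hz => h1.tail (ne_zero_of_le (schur_le hy hz) h),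
        fun hz => ⟨y, hy, h1.to_reflTransGen, ⟨z, hz⟩, h, 0, by
          rw [pow_zero, Matrix.one_apply_eq]; exact ofReal_ne_zero 0⟩⟩

variable [Fintype V]

/-- A potential for a Schur complement extends to a potential for the whole matrix. -/
theorem exists_isPotential_of_schur {x v : V → ℝ} (hx : IsPotential B (fun _ => α) x)
    (hv : IsPotential (schur C (ofReal α) B) w v) (hw : ∀ p ∈ C, w p = α) :
    ∃ u, IsPotential B w u := by
  have hM := hx.scaledBlock (C := C) fun _ _ => rfl
  set S := kleeneStar (scaledBlock C α B) with hS
  obtain ⟨K, hK⟩ := (Set.finite_range fun i => w i + v i - α - x i).bddAbove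
  have hK : ∀ i, w i + v i - α - x i ≤ K := fun i => hK ⟨i, rfl⟩
  -- The first term propagates `v` into `C` along walks inside `C`, but is +∞ where no walk leaves
  -- `C`. The second, a shift of `x`, is a potential on `C` that makes the minimum real; the choice
  -- of `K` keeps the inequalities from outside `C` into `C`.
  set U : C → Rmin := fun p => (∑ l : C, ∑ j ∈ Cᶜ,
    S p l * ((ofReal α)⁻¹ * B l j) * ofReal (v j)) + ofReal (K + x p) with hU
  have hU0 : ∀ p, U p ≠ 0 := fun p => ne_zero_of_le (add_le_right _ _) (ofReal_ne_zero _)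
  choose y hy using fun p => exists_ofReal (hU0 p)
  have hUj : ∀ (p l : C), ∀ j ∉ C, U p ≤ S p l * ((ofReal α)⁻¹ * B l j) * ofReal (v j) := by
    intro p l j hj
    exact (add_le_left _ _).trans ((sum_le (Finset.mem_univ l)).trans
      (sum_le (f := fun j => S p l * ((ofReal α)⁻¹ * B l j) * ofReal (v j))
        (Finset.mem_compl.2 hj)))
  have hpj : ∀ (p : C), ∀ j ∉ C, U p ≤ (ofReal α)⁻¹ * B p j * ofReal (v j) := by
    intro p j hj
    refine (hUj p p j hj).trans (mul_le_mul_left ?_ _)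
    conv_rhs => rw [← one_mul ((ofReal α)⁻¹ * B p j)]
    exact mul_le_mul_left (hM.kleeneStar_self_le p) _
  have hpq : ∀ p q : C, U p ≤ (ofReal α)⁻¹ * B p q * U q := by
    intro p q
    rw [hU]
    dsimp only
    rw [mul_add, Finset.mul_sum]
    refine le_add (le_sum fun l _ => ?_) ?_
    · rw [Finset.mul_sum]
      refine le_sum fun j hj => (hUj p l j (Finset.mem_compl.1 hj)).trans ?_
      simp only [← mul_assoc]
      exact mul_le_mul_left (mul_le_mul_left (mul_le_mul_left (hM.kleeneStar_le_mul p q l) _) _) _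
    · refine (add_le_right _ _).trans ?_
      have := mul_le_mul_left (hx.scaled_le (p := (p : V)) rfl q) (ofReal (K + x q))
      rw [← ofReal_add] at this
      exact (ofReal_le.2 (by linarith)).trans this
  have hip : ∀ i ∉ C, ∀ p : C, ofReal (w i + v i) ≤ B i p * U p := by
    intro i hi p
    rw [hU]
    dsimp only
    rw [mul_add, Finset.mul_sum]
    refine le_add (le_sum fun l _ => ?_) ?_
    · rw [Finset.mul_sum]
      refine le_sum fun j hj => (hv i j).trans ?_
      rw [← mul_assoc, ← mul_assoc]
      exact mul_le_mul_left (schur_le_mul hi (Finset.mem_compl.1 hj) p l) _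
    · have := mul_le_mul_left (isPotential_iff.1 hx i p) (ofReal (K + x p))
      rw [← ofReal_add] at this
      refine le_trans (ofReal_le.2 ?_) this
      have := hK i
      linarith
  have unscale : ∀ {p : V} {b c : Rmin} {r : ℝ}, p ∈ C → ofReal r ≤ (ofReal α)⁻¹ * b * c →
      ofReal (w p + r) ≤ b * c := by
    intro p b c r hp h
    rw [hw p hp, ofReal_add]
    have := mul_le_mul_right h (ofReal α)
    rwa [ofReal_inv, ← mul_assoc, ← mul_assoc, ← ofReal_add α (-α), add_neg_cancel, ofReal_zero,
      one_mul] at this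
  refine ⟨fun i => if h : i ∈ C then y ⟨i, h⟩ else v i, fun i j => ?_⟩
  by_cases hi : i ∈ C <;> by_cases hj : j ∈ C <;> simp only [hi, hj, dif_pos, dif_neg,
    not_false_eq_true]
  · refine unscale hi ?_
    rw [← hy, ← hy]
    exact hpq ⟨i, hi⟩ ⟨j, hj⟩
  · refine unscale hi ?_
    rw [← hy]
    exact hpj ⟨i, hi⟩ j hj
  · rw [← hy]
    exact hip i hi ⟨j, hj⟩
  · exact (hv i j).trans (mul_le_mul_left (schur_le hi hj) _)

end Schur

/-! ### The successive Schur complements -/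

section Stages

variable {V : Type*} [DecidableEq V]

theorem schur_eq_zero_of_row {C : Finset V} {α : ℝ} {B : Matrix V V Rmin} {i : V}
    (h : ∀ j, B i j = 0) (j : V) : schur C (ofReal α) B i j = 0 := by
  by_cases h' : i ∈ C ∨ j ∈ C
  · exact schur_eq_zero h'
  push Not at h'
  rw [schur_apply h'.1 h'.2]
  simp [h]

theorem schur_eq_zero_of_col {C : Finset V} {α : ℝ} {B : Matrix V V Rmin} {j : V}
    (h : ∀ i, B i j = 0) (i : V) : schur C (ofReal α) B i j = 0 := by
  by_cases h' : i ∈ C ∨ j ∈ C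
  · exact schur_eq_zero h'
  push Not at h'
  rw [schur_apply h'.1 h'.2]
  simp [h]

variable [Fintype V]

/-- If `b ≤ a`, a critical circuit of the Schur complement is tight for a potential of `B` of value
`a`. Unfolding its arcs gives a critical circuit of `B` through a node that was supposed not to be
critical. -/
theorem rhoMin_lt_rhoMin_schur {B : Matrix V V Rmin} {a b : ℝ} (ha : rhoMin B = ofReal a)
    (hb : rhoMin (schur (criticalNodes B) (ofReal a) B) = ofReal b) : a < b := by
  by_contra! hba
  obtain ⟨x, hx⟩ := exists_isPotential B ha.ge
  have hx' := hx.schur (C := criticalNodes B) (α := a) fun _ _ => rfl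
  obtain ⟨c, hc⟩ := exists_isCriticalCircuit (hb ▸ ofReal_ne_zero b)
  rw [isCriticalCircuit_iff hb] at hc
  have ht := hx'.tight_of_weight_le (c := c) (by
    rw [hc, ofReal_le, Finset.sum_const, Finset.card_univ, Fintype.card_fin, nsmul_eq_mul]
    exact mul_le_mul_of_nonneg_left hba (Nat.cast_nonneg _))
  have hlift : ∀ t, c.node t ∉ criticalNodes B ∧
      Relation.TransGen (Tight B (fun _ => a) x) (c.node t) (c.next t) := by
    intro t
    obtain ⟨h1, -, h3⟩ := hx.transGen_of_tight_schur (fun _ _ => rfl) (ht t)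
    exact ⟨h1, Relation.TransGen.mono (fun _ _ h => h.1) _ _ h3⟩
  have t : Fin c.length := ⟨0, c.length_pos⟩
  have h1 : Relation.TransGen (Tight B (fun _ => a) x) (c.node t) (c.node t) :=
    Relation.TransGen.closed le_rfl _ _ (Circuit.transGen (fun t => (hlift t).2) ⟨t, rfl⟩)
  obtain ⟨d, hd, hdt⟩ := exists_circuit_of_transGen h1
  refine (hlift t).1 (mem_criticalNodes.2 ⟨d, (isCriticalCircuit_iff ha d).2 ?_, hd⟩)
  rw [Circuit.weight_eq_of_tight hdt]
  simp

variable {A : Matrix V V Rmin}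

theorem criticalUnion_zero : criticalUnion A 0 = ∅ := by simp [criticalUnion]

theorem mem_criticalUnion {ℓ : ℕ} {v : V} :
    v ∈ criticalUnion A ℓ ↔ ∃ m, (1 ≤ m ∧ m ≤ ℓ) ∧ v ∈ criticalLayer A m := by
  simp [criticalUnion]

theorem criticalUnion_ne_univ {ℓ : ℕ} (h : ℓ < numCritical A) :
    criticalUnion A ℓ ≠ Finset.univ :=
  Nat.notMem_of_lt_sInf h

/-- Since `sInf ∅ = 0`, the hypothesis ensures that the infimum is attained, so the procedure does
terminate. -/
theorem criticalUnion_numCritical (h : 1 ≤ numCritical A) :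
    criticalUnion A (numCritical A) = Finset.univ := by
  refine Nat.sInf_mem (s := {ℓ | criticalUnion A ℓ = Finset.univ}) (Set.nonempty_iff_ne_empty.2 ?_)
  intro h0
  rw [numCritical, h0, Nat.sInf_empty] at h
  omega

theorem stage_succ {ℓ : ℕ} (h : 1 ≤ ℓ) :
    stage A (ℓ + 1) = schur (criticalLayer A ℓ) (criticalValue A ℓ) (stage A ℓ) := by
  obtain ⟨m, rfl⟩ : ∃ m, ℓ = m + 1 := ⟨ℓ - 1, by omega⟩
  rfl

theorem criticalValue_ne_zero_of_transGen {ℓ : ℕ} (hℓ : ℓ < numCritical A)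
    (h : ∀ i j, i ∉ criticalUnion A ℓ → j ∉ criticalUnion A ℓ →
      Relation.TransGen (fun a b => stage A (ℓ + 1) a b ≠ 0) i j) :
    criticalValue A (ℓ + 1) ≠ 0 := by
  obtain ⟨v, hv⟩ : ∃ v, v ∉ criticalUnion A ℓ := by
    by_contra! h'
    exact criticalUnion_ne_univ hℓ (Finset.eq_univ_iff_forall.2 h')
  obtain ⟨c, -, hc⟩ := exists_circuit_of_transGen (h v v hv hv)
  exact rhoMin_ne_zero (c := c) hc

/-- The three assertions advance together: strong connectivity on the remaining nodes yields a
circuit, hence a finite critical value, hence the potential needed to carry connectivity through the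
next Schur complement. -/
theorem stage_invariant (hA : IsIrreducible A) (ℓ : ℕ) (hℓ : ℓ < numCritical A) :
    (∀ i j, i ∈ criticalUnion A ℓ ∨ j ∈ criticalUnion A ℓ → stage A (ℓ + 1) i j = 0) ∧
    (∀ i j, i ∉ criticalUnion A ℓ → j ∉ criticalUnion A ℓ →
      Relation.TransGen (fun a b => stage A (ℓ + 1) a b ≠ 0) i j) ∧
    criticalValue A (ℓ + 1) ≠ 0 := by
  induction ℓ with
  | zero =>
    have h2 : ∀ i j, i ∉ criticalUnion A 0 → j ∉ criticalUnion A 0 →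
        Relation.TransGen (fun a b => stage A (0 + 1) a b ≠ 0) i j := fun i j _ _ => hA i j
    exact ⟨by simp [criticalUnion_zero], h2, criticalValue_ne_zero_of_transGen hℓ h2⟩
  | succ ℓ ih =>
    obtain ⟨h1, h2, h3⟩ := ih (by omega)
    obtain ⟨a, ha⟩ := exists_ofReal h3
    have hmem : ∀ v, v ∈ criticalUnion A (ℓ + 1) ↔
        v ∈ criticalUnion A ℓ ∨ v ∈ criticalLayer A (ℓ + 1) := by
      intro v
      simp only [mem_criticalUnion]
      constructor
      · rintro ⟨m, ⟨hm, hm'⟩, hv⟩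
        rcases hm'.lt_or_eq with h | rfl
        · exact .inl ⟨m, ⟨hm, by omega⟩, hv⟩
        · exact .inr hv
      · rintro (⟨m, hm, hv⟩ | hv)
        · exact ⟨m, by omega, hv⟩
        · exact ⟨ℓ + 1, by omega, hv⟩
    have hs := stage_succ (A := A) (show 1 ≤ ℓ + 1 by omega)
    rw [ha] at hs
    have h2' : ∀ i j, i ∉ criticalUnion A (ℓ + 1) → j ∉ criticalUnion A (ℓ + 1) →
        Relation.TransGen (fun a b => stage A (ℓ + 1 + 1) a b ≠ 0) i j := by
      intro i j hi hj
      rw [hs]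
      rw [hmem, not_or] at hi hj
      obtain ⟨x, hx⟩ := exists_isPotential (stage A (ℓ + 1)) (α := a) ha.ge
      exact transGen_schur hx hi.2 hj.2 (h2 i j hi.1 hj.1)
    refine ⟨fun i j hij => ?_, h2', criticalValue_ne_zero_of_transGen hℓ h2'⟩
    rw [hs]
    rw [hmem, hmem] at hij
    rcases hij with (hi | hi) | (hj | hj)
    · exact schur_eq_zero_of_row (fun j => h1 i j (.inl hi)) j
    · exact schur_eq_zero (.inl hi)
    · exact schur_eq_zero_of_col (fun i => h1 i j (.inr hj)) i
    · exact schur_eq_zero (.inr hj)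

theorem notMem_criticalUnion_of_mem_criticalLayer (hA : IsIrreducible A) {ℓ : ℕ}
    (hℓ : ℓ < numCritical A) {v : V} (hv : v ∈ criticalLayer A (ℓ + 1)) :
    v ∉ criticalUnion A ℓ := by
  intro h
  obtain ⟨c, hc, t, rfl⟩ := mem_criticalNodes.1 hv
  exact hc.1 t ((stage_invariant hA ℓ hℓ).1 _ _ (.inl h))

/-- The real numbers `a ℓ` are the critical values of `A`, `lev` gives the critical layer of a
node, and `u` is a potential which witnesses that every circuit `c` satisfies
`|c|_A ≥ ∑_m α_m |c|_{C_m}`. -/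
structure IsCriticalData (A : Matrix V V Rmin) (a : ℕ → ℝ) (lev : V → ℕ) (u : V → ℝ) : Prop where
  value : ∀ ℓ ∈ Finset.Icc 1 (numCritical A), criticalValue A ℓ = ofReal (a ℓ)
  lt_succ : ∀ ℓ, 1 ≤ ℓ → ℓ < numCritical A → a ℓ < a (ℓ + 1)
  lev_mem : ∀ v, lev v ∈ Finset.Icc 1 (numCritical A)
  layer : ∀ ℓ ∈ Finset.Icc 1 (numCritical A), ∀ v, v ∈ criticalLayer A ℓ ↔ lev v = ℓ
  layer_nonempty : ∀ ℓ ∈ Finset.Icc 1 (numCritical A), (criticalLayer A ℓ).Nonempty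
  potential : IsPotential A (fun v => a (lev v)) u
  -- This puts every node of C^ℓ on a critical circuit of order ℓ.
  transGen : ∀ v, Relation.TransGen (fun i j =>
    Tight A (fun v => a (lev v)) u i j ∧ lev i ≤ lev v ∧ lev j ≤ lev v) v v

/-- The potential is built from the last stage back to `A`, and the resulting vector is then
inherited by all stages. A critical circuit of a stage is tight for it, and its arcs unfold stage by
stage into tight paths of `A` that stay in layers up to the current one. -/
theorem exists_isCriticalData (hA : IsIrreducible A) (hk : 1 ≤ numCritical A) :
    ∃ a lev u, IsCriticalData A a lev u := by
  set k := numCritical A with hkdef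
  have hval : ∀ ℓ, ∃ r, ℓ ∈ Finset.Icc 1 k → criticalValue A ℓ = ofReal r := by
    intro ℓ
    by_cases hℓ : ℓ ∈ Finset.Icc 1 k
    · have := Finset.mem_Icc.1 hℓ
      obtain ⟨m, rfl⟩ : ∃ m, ℓ = m + 1 := ⟨ℓ - 1, by omega⟩
      obtain ⟨r, hr⟩ := exists_ofReal (stage_invariant hA m (by omega)).2.2
      exact ⟨r, fun _ => hr⟩
    · exact ⟨0, fun h => absurd h hℓ⟩
  choose a ha using hval
  have hlev : ∀ v : V, ∃ m ∈ Finset.Icc 1 k, v ∈ criticalLayer A m := by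
    intro v
    have hv : v ∈ criticalUnion A k := by
      rw [criticalUnion_numCritical hk]
      exact Finset.mem_univ v
    obtain ⟨m, hm, hv⟩ := mem_criticalUnion.1 hv
    exact ⟨m, Finset.mem_Icc.2 hm, hv⟩
  choose lev hlev hlev' using hlev
  have hnot : ∀ m ℓ, 1 ≤ m → m < ℓ → ℓ ≤ k → ∀ v, v ∈ criticalLayer A m →
      v ∉ criticalLayer A ℓ := by
    intro m ℓ hm hmℓ hℓ v hv hv'
    obtain ⟨p, rfl⟩ : ∃ p, ℓ = p + 1 := ⟨ℓ - 1, by omega⟩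
    exact notMem_criticalUnion_of_mem_criticalLayer hA (by omega) hv'
      (mem_criticalUnion.2 ⟨m, by omega, hv⟩)
  have hlayer : ∀ ℓ ∈ Finset.Icc 1 k, ∀ v, v ∈ criticalLayer A ℓ ↔ lev v = ℓ := by
    intro ℓ hℓ v
    have h1 := Finset.mem_Icc.1 hℓ
    have h2 := Finset.mem_Icc.1 (hlev v)
    refine ⟨fun hv => ?_, fun h => h ▸ hlev' v⟩
    rcases lt_trichotomy (lev v) ℓ with h | h | h
    · exact absurd hv (hnot _ _ h2.1 h h1.2 v (hlev' v))
    · exact h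
    · exact absurd (hlev' v) (hnot _ _ h1.1 h h2.2 v hv)
  have hstage : ∀ ℓ, 1 ≤ ℓ → ℓ ≤ k →
      stage A (ℓ + 1) = schur (criticalLayer A ℓ) (ofReal (a ℓ)) (stage A ℓ) := by
    intro ℓ h1 h2
    rw [stage_succ h1, ha ℓ (Finset.mem_Icc.2 ⟨h1, h2⟩)]
  have hβ : ∀ ℓ, 1 ≤ ℓ → ℓ ≤ k → ∀ p ∈ criticalLayer A ℓ, a (lev p) = a ℓ := by
    intro ℓ h1 h2 p hp
    rw [(hlayer ℓ (Finset.mem_Icc.2 ⟨h1, h2⟩) p).1 hp]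
  have hpot : ∀ d ℓ, 1 ≤ ℓ → ℓ + d = k →
      ∃ u, IsPotential (stage A ℓ) (fun v => a (lev v)) u := by
    intro d
    induction d with
    | zero =>
      intro ℓ h1 h2
      obtain rfl : ℓ = k := h2
      obtain ⟨x, hx⟩ := exists_isPotential (stage A k) (α := a k)
        (ha k (Finset.mem_Icc.2 ⟨h1, le_rfl⟩)).ge
      refine ⟨x, fun i j => ?_⟩
      -- At the last stage the rows of the earlier layers are +∞, so only the weight `a k` matters.
      by_cases hi : lev i = k
      · dsimp only
        rw [hi]
        exact hx i j
      · obtain ⟨m, hm⟩ : ∃ m, k = m + 1 := ⟨k - 1, by omega⟩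
        have h3 := Finset.mem_Icc.1 (hlev i)
        rw [hm, (stage_invariant hA m (by omega)).1 i j
          (.inl (mem_criticalUnion.2 ⟨lev i, by omega, hlev' i⟩)), zero_mul]
        exact Tropical.le_zero _
    | succ d ih =>
      intro ℓ h1 h2
      obtain ⟨v, hv⟩ := ih (ℓ + 1) (by omega) (by omega)
      rw [hstage ℓ h1 (by omega)] at hv
      obtain ⟨x, hx⟩ := exists_isPotential (stage A ℓ) (α := a ℓ)
        (ha ℓ (Finset.mem_Icc.2 ⟨h1, by omega⟩)).ge
      exact exists_isPotential_of_schur hx hv (hβ ℓ h1 (by omega))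
  obtain ⟨u, hu⟩ := hpot (k - 1) 1 le_rfl (by omega)
  -- The vectors of the downward induction change with the stage; from here on a single `u` serves
  -- all stages.
  have hu' : ∀ ℓ, 1 ≤ ℓ → ℓ ≤ k → IsPotential (stage A ℓ) (fun v => a (lev v)) u := by
    intro ℓ h1
    induction ℓ, h1 using Nat.le_induction with
    | base => exact fun _ => hu
    | succ ℓ h1 ih =>
      intro h2
      rw [hstage ℓ h1 (by omega)]
      exact (ih (by omega)).schur (hβ ℓ h1 (by omega))
  have hlift : ∀ m ℓ, 1 ≤ ℓ → ℓ ≤ m → ℓ ≤ k → ∀ i j, lev i ≤ m → lev j ≤ m →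
      Tight (stage A ℓ) (fun v => a (lev v)) u i j →
      Relation.TransGen (fun i j =>
        Tight A (fun v => a (lev v)) u i j ∧ lev i ≤ m ∧ lev j ≤ m) i j := by
    intro m ℓ h1
    induction ℓ, h1 using Nat.le_induction with
    | base => exact fun _ _ i j hi hj h => .single ⟨h, hi, hj⟩
    | succ ℓ h1 ih =>
      intro h2 h3 i j hi hj h
      rw [hstage ℓ h1 (by omega)] at h
      have h := ((hu' ℓ h1 (by omega)).transGen_of_tight_schur (hβ ℓ h1 (by omega)) h).2.2
      have hle : ∀ p ∈ criticalLayer A ℓ, lev p ≤ m := by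
        intro p hp
        rw [(hlayer ℓ (Finset.mem_Icc.2 ⟨h1, by omega⟩) p).1 hp]
        omega
      refine Relation.TransGen.closed (fun p q hpq => ?_) _ _ h
      refine ih (by omega) (by omega) p q ?_ ?_ hpq.1
      · rcases hpq.2.1 with rfl | hp
        exacts [hi, hle p hp]
      · rcases hpq.2.2 with rfl | hq
        exacts [hj, hle q hq]
  refine ⟨a, lev, u, ha, fun ℓ h1 h2 => ?_, hlev, hlayer, fun ℓ hℓ => ?_, hu, fun v => ?_⟩
  · refine rhoMin_lt_rhoMin_schur (ha ℓ (Finset.mem_Icc.2 ⟨h1, h2.le⟩)) ?_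
    exact hstage ℓ h1 h2.le ▸ ha (ℓ + 1) (Finset.mem_Icc.2 ⟨by omega, h2⟩)
  · obtain ⟨c, hc⟩ := exists_isCriticalCircuit (B := stage A ℓ)
      (by change criticalValue A ℓ ≠ 0; rw [ha ℓ hℓ]; exact ofReal_ne_zero _)
    exact ⟨c.node ⟨0, c.length_pos⟩, mem_criticalNodes.2 ⟨c, hc, _, rfl⟩⟩
  · obtain ⟨h1, h2⟩ := Finset.mem_Icc.1 (hlev v)
    obtain ⟨c, hc, hv⟩ := mem_criticalNodes.1 (hlev' v)
    have hlevc : ∀ t, lev (c.node t) = lev v := fun t =>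
      (hlayer _ (hlev v) _).1 (mem_criticalNodes.2 ⟨c, hc, t, rfl⟩)
    have hlevn : ∀ t, lev (c.next t) = lev v := fun t => hlevc _
    have hw := (isCriticalCircuit_iff (ha _ (hlev v)) c).1 hc
    have ht := (hu' _ h1 h2).tight_of_weight_le (c := c) (by simp [hw, hlevc])
    refine Relation.TransGen.closed (fun p q hpq => ?_) _ _ (Circuit.transGen
      (r := fun p q => Tight (stage A (lev v)) (fun v => a (lev v)) u p q ∧
        lev p = lev v ∧ lev q = lev v) (fun t => ⟨ht t, hlevc t, hlevn t⟩) hv)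
    exact hlift _ _ h1 le_rfl h2 p q hpq.2.1.le hpq.2.2.le hpq.1

end Stages

/-! ### Disjoint circuit covers and permutations -/

section Covers

variable {V : Type*} [Finite V]

theorem minimalPeriod_perm_pos (τ : Equiv.Perm V) (v : V) : 0 < Function.minimalPeriod τ v :=
  Function.minimalPeriod_pos_of_mem_periodicPts (τ.injective.mem_periodicPts v)

/-- The circuit formed by the cycle of `τ` through `v`. -/
def permCircuit (τ : Equiv.Perm V) (v : V) : Circuit V :=
  circuitOfFun (Function.minimalPeriod τ v) (minimalPeriod_perm_pos τ v) fun t => τ^[t] v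

theorem permCircuit_next (τ : Equiv.Perm V) (v : V) (t : Fin (permCircuit τ v).length) :
    (permCircuit τ v).next t = τ ((permCircuit τ v).node t) := by
  refine (circuitOfFun_next (minimalPeriod_perm_pos τ v)
    (Function.iterate_minimalPeriod (f := τ) (x := v)) t).trans ?_
  exact Function.iterate_succ_apply' _ _ _

theorem permCircuit_isElementary (τ : Equiv.Perm V) (v : V) :
    (permCircuit τ v).IsElementary := by
  intro s t h
  exact Fin.ext (Function.iterate_injOn_Iio_minimalPeriod s.2 t.2 h)

theorem mem_support_permCircuit {τ : Equiv.Perm V} {v w : V} :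
    w ∈ (permCircuit τ v).support ↔ τ.SameCycle v w := by
  constructor
  · rintro ⟨t, rfl⟩
    exact ⟨(t : ℕ), by rw [zpow_natCast, ← Equiv.Perm.iterate_eq_pow]; rfl⟩
  · intro h
    obtain ⟨n, hn⟩ := h.exists_nat_pow_eq
    refine ⟨⟨n % Function.minimalPeriod τ v, Nat.mod_lt _ (minimalPeriod_perm_pos τ v)⟩, ?_⟩
    rw [← hn, ← Equiv.Perm.iterate_eq_pow]
    exact Function.iterate_mod_minimalPeriod_eq

theorem prop_of_sameCycle {τ : Equiv.Perm V} {p : V → Prop} (hp : ∀ v, p v → p (τ v)) {v w : V}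
    (h : τ.SameCycle v w) (hv : p v) : p w := by
  obtain ⟨n, rfl⟩ := h.exists_nat_pow_eq
  induction n with
  | zero => exact hv
  | succ n ih =>
    rw [pow_succ', Equiv.Perm.mul_apply]
    exact hp _ (ih ⟨n, rfl⟩)

theorem hasDisjointCircuitCover_of_perm {G : DirGraph V} (τ : Equiv.Perm V)
    (h : ∀ i ∈ G.nodes, G.arc i (τ i)) : HasDisjointCircuitCover G := by
  have hτ : ∀ v, v ∈ G.nodes → τ v ∈ G.nodes := fun v hv => G.target_mem _ _ (h v hv)
  -- A cycle gives a different `Circuit` for each starting node; one representative per cycle makes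
  -- distinct circuits disjoint.
  set rep : V → V := fun v =>
    Quotient.out (Quotient.mk (Equiv.Perm.SameCycle.setoid τ) v) with hrep
  have hrep1 : ∀ v, τ.SameCycle (rep v) v := fun v =>
    Quotient.mk_out (s := Equiv.Perm.SameCycle.setoid τ) v
  have hrep2 : ∀ v w, τ.SameCycle v w → rep v = rep w := fun v w hvw =>
    congrArg Quotient.out (Quotient.sound (s := Equiv.Perm.SameCycle.setoid τ) hvw)
  refine ⟨(fun v => permCircuit τ (rep v)) '' G.nodes, ?_, ?_, fun v hv =>
    ⟨_, ⟨v, hv, rfl⟩, mem_support_permCircuit.2 (hrep1 v)⟩⟩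
  · rintro _ ⟨v, hv, rfl⟩
    refine ⟨fun t => ?_, permCircuit_isElementary τ _⟩
    rw [permCircuit_next]
    have ht : τ.SameCycle (rep v) ((permCircuit τ (rep v)).node t) :=
      mem_support_permCircuit.1 ⟨t, rfl⟩
    exact h _ (prop_of_sameCycle hτ ((hrep1 v).symm.trans ht) hv)
  · rintro _ ⟨v, hv, rfl⟩ _ ⟨w, hw, rfl⟩ hne
    refine Set.disjoint_left.2 fun x hx hx' => hne ?_
    have h1 := mem_support_permCircuit.1 hx
    have h2 := mem_support_permCircuit.1 hx'
    have h3 := hrep2 v w ((hrep1 v).symm.trans (h1.trans (h2.symm.trans (hrep1 w))))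
    simp only [h3]

/-- Send a node of the graph to its successor on the cover and fix the others. This is injective
because the circuits are disjoint, elementary, and contained in the graph; finiteness does the rest.
-/
theorem exists_perm_of_hasDisjointCircuitCover {G : DirGraph V}
    (h : HasDisjointCircuitCover G) : ∃ τ : Equiv.Perm V, (∀ i ∉ G.nodes, τ i = i) ∧
      ∀ i ∈ G.nodes, G.arc i (τ i) := by
  classical
  obtain ⟨S, h1, h2, h3⟩ := h
  have hsucc : ∀ v, ∃ w, (v ∉ G.nodes ∧ w = v) ∨
      ∃ c ∈ S, ∃ t, c.node t = v ∧ c.next t = w := by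
    intro v
    by_cases hv : v ∈ G.nodes
    · obtain ⟨c, hc, t, ht⟩ := h3 v hv
      exact ⟨c.next t, .inr ⟨c, hc, t, ht, rfl⟩⟩
    · exact ⟨v, .inl ⟨hv, rfl⟩⟩
  choose f hf using hsucc
  have hinj : Function.Injective f := by
    intro v w hvw
    rcases hf v with ⟨hv, hv'⟩ | ⟨c, hc, t, rfl, ht⟩ <;>
      rcases hf w with ⟨hw, hw'⟩ | ⟨d, hd, s, rfl, hs⟩
    · rw [← hv', ← hw', hvw]
    · refine absurd ?_ hv
      rw [← hv', hvw, ← hs]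
      exact G.target_mem _ _ ((h1 d hd).1 s)
    · refine absurd ?_ hw
      rw [← hw', ← hvw, ← ht]
      exact G.target_mem _ _ ((h1 c hc).1 t)
    · have hcd : c = d := by
        by_contra hne
        have hdisj := Set.disjoint_left.1 (h2 hc hd hne)
        exact @hdisj (c.next t) ⟨_, rfl⟩ (by rw [ht, hvw, ← hs]; exact ⟨_, rfl⟩)
      subst hcd
      have := (h1 c hc).2 (ht.trans (hvw.trans hs.symm))
      rw [(finRotate c.length).injective this]
  refine ⟨Equiv.ofBijective f (Finite.injective_iff_bijective.1 hinj), fun i hi => ?_,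
    fun i hi => ?_⟩
  · rcases hf i with ⟨-, hi'⟩ | ⟨c, hc, t, rfl, ht⟩
    · exact hi'
    · exact absurd (G.source_mem _ _ ((h1 c hc).1 t)) hi
  · rcases hf i with ⟨hi', -⟩ | ⟨c, hc, t, rfl, ht⟩
    · exact absurd hi hi'
    · change G.arc _ (f _)
      rw [← ht]
      exact (h1 c hc).1 t

end Covers

/-! ### Critical circuits of a given order -/

section Orders

variable {V : Type*} [Fintype V] [DecidableEq V] {A : Matrix V V Rmin} {a : ℕ → ℝ} {lev : V → ℕ}
  {u : V → ℝ}

namespace IsCriticalData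

theorem value_lt (D : IsCriticalData A a lev u) {m ℓ : ℕ} (hm : 1 ≤ m) (h : m < ℓ)
    (hℓ : ℓ ≤ numCritical A) : a m < a ℓ := by
  induction ℓ, h using Nat.le_induction with
  | base => exact D.lt_succ m hm (by omega)
  | succ ℓ h ih => exact (ih (by omega)).trans (D.lt_succ ℓ (by omega) (by omega))

theorem value_le (D : IsCriticalData A a lev u) {m ℓ : ℕ} (hm : 1 ≤ m) (h : m ≤ ℓ)
    (hℓ : ℓ ≤ numCritical A) : a m ≤ a ℓ := by
  rcases h.lt_or_eq with h | rfl
  · exact (D.value_lt hm h hℓ).le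
  · exact le_rfl

theorem one_le_lev (D : IsCriticalData A a lev u) (v : V) : 1 ≤ lev v :=
  (Finset.mem_Icc.1 (D.lev_mem v)).1

theorem lev_le (D : IsCriticalData A a lev u) (v : V) : lev v ≤ numCritical A :=
  (Finset.mem_Icc.1 (D.lev_mem v)).2

theorem mem_criticalUnion (D : IsCriticalData A a lev u) {ℓ : ℕ} (hℓ : ℓ ≤ numCritical A)
    (v : V) : v ∈ criticalUnion A ℓ ↔ lev v ≤ ℓ := by
  rw [MinPlus.mem_criticalUnion]
  constructor
  · rintro ⟨m, hm, hv⟩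
    rw [(D.layer m (Finset.mem_Icc.2 (by omega)) v).1 hv]
    exact hm.2
  · exact fun h => ⟨lev v, ⟨D.one_le_lev v, h⟩, (D.layer _ (D.lev_mem v) v).2 rfl⟩

/-- The counts in the definition are regrouped arc by arc, according to the layer of the initial
node. -/
theorem isCriticalCircuitOfOrder_iff_weight (D : IsCriticalData A a lev u) {ℓ : ℕ} (h1 : 1 ≤ ℓ)
    (hℓ : ℓ ≤ numCritical A) (c : Circuit V) :
    IsCriticalCircuitOfOrder A ℓ c ↔
      c.weight A = ofReal (∑ t, if lev (c.node t) < ℓ then a (lev (c.node t)) else a ℓ) := by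
  classical
  set X : ℝ := ∑ t, if lev (c.node t) < ℓ then a (lev (c.node t)) else 0 with hX
  set Y : ℝ := ∑ t, if lev (c.node t) < ℓ then 0 else a ℓ with hY
  have hXY : (∑ t, if lev (c.node t) < ℓ then a (lev (c.node t)) else a ℓ) = X + Y := by
    rw [hX, hY, ← Finset.sum_add_distrib]
    refine Finset.sum_congr rfl fun t _ => ?_
    split_ifs <;> simp
  have hweight : orderWeight A ℓ c = c.weight A * ofReal (-X) := by
    have hprod : ∀ m ∈ Finset.Ico 1 ℓ, (criticalValue A m ^ c.count (criticalLayer A m))⁻¹ =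
        ofReal (∑ t, if lev (c.node t) = m then -a m else 0) := by
      intro m hm
      have hm' : m ∈ Finset.Icc 1 (numCritical A) := by
        have := Finset.mem_Ico.1 hm
        exact Finset.mem_Icc.2 (by omega)
      rw [D.value m hm', ofReal_pow, ofReal_inv, Circuit.count, ← Finset.sum_filter,
        Finset.sum_const, nsmul_eq_mul]
      congr 1
      rw [mul_neg]
      congr 3
      refine congrArg Finset.card ?_
      ext t
      simp only [Finset.mem_filter, Finset.mem_univ, true_and, Finset.mem_coe, D.layer m hm']
    rw [orderWeight, Finset.prod_congr rfl hprod, ← ofReal_sum, Finset.sum_comm, hX,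
      ← Finset.sum_neg_distrib]
    congr 3
    ext t
    rw [Finset.sum_ite_eq]
    have := D.one_le_lev (c.node t)
    by_cases h : lev (c.node t) < ℓ
    · rw [if_pos (Finset.mem_Ico.2 ⟨this, h⟩), if_pos h]
    · rw [if_neg (fun h' => h (Finset.mem_Ico.1 h').2), if_neg h, neg_zero]
  have hlength : criticalValue A ℓ ^ orderLength A ℓ c = ofReal Y := by
    rw [D.value ℓ (Finset.mem_Icc.2 ⟨h1, hℓ⟩), ofReal_pow, hY, orderLength, Circuit.count,
      Finset.sum_ite, Finset.sum_const_zero, zero_add, Finset.sum_const, nsmul_eq_mul]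
    congr 4
    ext t
    simp only [Finset.mem_filter, Finset.mem_univ, true_and, Set.mem_ofPred_eq,
      D.mem_criticalUnion (show ℓ - 1 ≤ numCritical A by omega)]
    omega
  rw [IsCriticalCircuitOfOrder, hweight, hlength, hXY, Circuit.isIn_graph_iff,
    ← mul_ofReal_inj X (x := c.weight A * ofReal (-X)), mul_assoc, ← ofReal_add, ← ofReal_add,
    neg_add_cancel, ofReal_zero, mul_one, add_comm Y]
  exact ⟨fun h => h.2, fun h => ⟨h ▸ ofReal_ne_zero _, h⟩⟩

/-- The prescribed weight is the sum of min(a(lev v), a(ℓ)), at most the sum of a(lev v), itself at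
most the weight by the potential. Equality throughout means tight arcs and, as `a` is strictly
increasing, no layer beyond ℓ. -/
theorem isCriticalCircuitOfOrder_iff (D : IsCriticalData A a lev u) {ℓ : ℕ} (h1 : 1 ≤ ℓ)
    (hℓ : ℓ ≤ numCritical A) (c : Circuit V) :
    IsCriticalCircuitOfOrder A ℓ c ↔
      ∀ t, Tight A (fun v => a (lev v)) u (c.node t) (c.next t) ∧ lev (c.node t) ≤ ℓ := by
  rw [D.isCriticalCircuitOfOrder_iff_weight h1 hℓ]
  have hle : ∀ v, (if lev v < ℓ then a (lev v) else a ℓ) ≤ a (lev v) := by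
    intro v
    split_ifs with h
    · exact le_rfl
    · exact D.value_le h1 (not_lt.1 h) (D.lev_le v)
  constructor
  · intro h
    have hsum := Finset.sum_le_sum fun t (_ : t ∈ Finset.univ) => hle (c.node t)
    have hge := D.potential.le_weight c
    rw [h, ofReal_le] at hge
    have heq := (Finset.sum_eq_sum_iff_of_le fun t (_ : t ∈ Finset.univ) => hle (c.node t)).1
      (le_antisymm hsum hge)
    intro t
    refine ⟨D.potential.tight_of_weight_le (h.le.trans (ofReal_le.2 hsum)) t, ?_⟩
    by_contra! hlt
    have := heq t (Finset.mem_univ t)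
    rw [if_neg (by omega)] at this
    exact (D.value_lt h1 hlt (D.lev_le _)).ne this
  · intro h
    rw [Circuit.weight_eq_of_tight fun t => (h t).1]
    refine congrArg ofReal (Finset.sum_congr rfl fun t _ => ?_)
    have := (h t).2
    split_ifs with h'
    · rfl
    · rw [show lev (c.node t) = ℓ by omega]

theorem mem_nodes_criticalGraph (D : IsCriticalData A a lev u) {ℓ : ℕ} (h1 : 1 ≤ ℓ)
    (hℓ : ℓ ≤ numCritical A) (v : V) : v ∈ (criticalGraph A ℓ).nodes ↔ lev v ≤ ℓ := by
  rw [criticalGraph, if_neg (by omega)]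
  constructor
  · rintro ⟨c, hc, t, rfl⟩
    exact ((D.isCriticalCircuitOfOrder_iff h1 hℓ c).1 hc t).2
  · intro hv
    obtain ⟨c, hvc, hc⟩ := exists_circuit_of_transGen (D.transGen v)
    exact ⟨c, (D.isCriticalCircuitOfOrder_iff h1 hℓ c).2
      fun t => ⟨(hc t).1, (hc t).2.1.trans hv⟩, hvc⟩

/-- The critical graph of order `ℓ` has a disjoint circuit cover if and only if some permutation
moves the nodes of the first `ℓ` layers along tight arcs, and fixes the other nodes. -/
theorem hasDisjointCircuitCover_iff (D : IsCriticalData A a lev u) {ℓ : ℕ}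
    (hℓ : ℓ ≤ numCritical A) :
    HasDisjointCircuitCover (criticalGraph A ℓ) ↔
      ∃ τ : Equiv.Perm V, (∀ i, ℓ < lev i → τ i = i) ∧
        ∀ i, lev i ≤ ℓ → Tight A (fun v => a (lev v)) u i (τ i) := by
  rcases Nat.eq_zero_or_pos ℓ with rfl | h1
  · rw [criticalGraph, if_pos rfl]
    refine iff_of_true ⟨∅, by simp [emptyGraph]⟩ ⟨1, fun _ _ => rfl, fun i hi => ?_⟩
    have := D.one_le_lev i
    omega
  have hn := D.mem_nodes_criticalGraph h1 hℓ
  constructor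
  · intro h
    obtain ⟨τ, hτ, hτ'⟩ := exists_perm_of_hasDisjointCircuitCover h
    refine ⟨τ, fun i hi => hτ i (by rw [hn]; omega), fun i hi => ?_⟩
    have harc := hτ' i ((hn i).2 hi)
    rw [criticalGraph, if_neg (by omega)] at harc
    obtain ⟨c, hc, t, rfl, ht⟩ := harc
    rw [← ht]
    exact ((D.isCriticalCircuitOfOrder_iff h1 hℓ c).1 hc t).1
  · rintro ⟨τ, hτ, hτ'⟩
    refine hasDisjointCircuitCover_of_perm τ fun i hi => ?_
    rw [hn] at hi
    -- An image outside C^ℓ would be fixed by `τ`, hence equal to its preimage by injectivity.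
    have hstable : ∀ v, lev v ≤ ℓ → lev (τ v) ≤ ℓ := by
      intro v hv
      by_contra! h
      rw [τ.injective (hτ _ h)] at h
      omega
    rw [criticalGraph, if_neg (by omega)]
    refine ⟨permCircuit τ i, (D.isCriticalCircuitOfOrder_iff h1 hℓ _).2 fun t => ?_, ?_⟩
    · have ht := prop_of_sameCycle hstable (mem_support_permCircuit.1 ⟨t, rfl⟩) hi
      rw [permCircuit_next]
      exact ⟨hτ' _ ht, ht⟩
    · obtain ⟨t, ht⟩ := mem_support_permCircuit.2 (Equiv.Perm.SameCycle.refl τ i)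
      exact ⟨t, ht, by rw [permCircuit_next, ht]⟩

end IsCriticalData

end Orders

/-! ### The characteristic polynomial -/

section CharPoly

variable {V : Type*} [DecidableEq V] {A : Matrix V V Rmin}

theorem natDegree_charPoly_entry (A : Matrix V V Rmin) (i j : V) :
    ((Matrix.diagonal (fun _ : V => (Polynomial.X : Polynomial Rmin)) +
      A.map Polynomial.C) i j).natDegree ≤ if i = j then 1 else 0 := by
  rw [Matrix.add_apply, Matrix.map_apply, Matrix.diagonal_apply]
  split_ifs
  · exact (Polynomial.natDegree_X_add_C _).le
  · simp

variable [Fintype V]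

theorem eval_charPoly (A : Matrix V V Rmin) (y : Rmin) :
    (charPoly A).eval y =
      ∑ τ : Equiv.Perm V, ∏ i, (Matrix.diagonal (fun _ : V => y) + A) i (τ i) := by
  have h : (charPoly A).eval y = (Matrix.diagonal (fun _ : V => y) + A).permanent := by
    rw [charPoly, Matrix.permanent, Matrix.permanent, Polynomial.eval_finsetSum]
    refine Finset.sum_congr rfl fun σ _ => ?_
    rw [Polynomial.eval_prod]
    refine Finset.prod_congr rfl fun i _ => ?_
    rw [Matrix.add_apply, Matrix.add_apply, Polynomial.eval_add, Matrix.map_apply,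
      Polynomial.eval_C, Matrix.diagonal_apply, Matrix.diagonal_apply]
    split_ifs <;> simp
  -- `Matrix.permanent` permutes the row index; transposing makes the arcs run from `i` to `τ i`.
  rw [h, ← Matrix.permanent_transpose]
  rfl

/-- A permutation other than the identity uses an off-diagonal entry, which is constant; so only the
identity contributes to the top coefficient. -/
theorem natDegree_charPoly_term {σ : Equiv.Perm V} (hσ : σ ≠ 1) :
    (∏ i, (Matrix.diagonal (fun _ : V => (Polynomial.X : Polynomial Rmin)) +
      A.map Polynomial.C) (σ i) i).natDegree < Fintype.card V := by
  obtain ⟨i, hi⟩ : ∃ i, σ i ≠ i := by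
    by_contra! h
    exact hσ (Equiv.ext h)
  refine (Polynomial.natDegree_prod_le _ _).trans_lt ?_
  refine (Finset.sum_le_sum fun i _ => natDegree_charPoly_entry A (σ i) i).trans_lt ?_
  rw [← Finset.card_univ, Finset.card_eq_sum_ones]
  refine Finset.sum_lt_sum (fun i _ => ?_) ⟨i, Finset.mem_univ i, ?_⟩
  · split_ifs <;> simp
  · rw [if_neg hi]
    exact one_pos

theorem monic_charPoly_diagonal_term (A : Matrix V V Rmin) :
    (∏ i, (Matrix.diagonal (fun _ : V => (Polynomial.X : Polynomial Rmin)) +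
      A.map Polynomial.C) i i).Monic ∧
    (∏ i, (Matrix.diagonal (fun _ : V => (Polynomial.X : Polynomial Rmin)) +
      A.map Polynomial.C) i i).natDegree = Fintype.card V := by
  simp only [Matrix.add_apply, Matrix.map_apply, Matrix.diagonal_apply_eq]
  have h : ∀ i ∈ Finset.univ, (Polynomial.X + Polynomial.C (A i i)).Monic :=
    fun i _ => Polynomial.monic_X_add_C _
  refine ⟨Polynomial.monic_prod_of_monic _ _ h, ?_⟩
  rw [Polynomial.natDegree_prod_of_monic _ _ h]
  simp

theorem natDegree_charPoly_le (A : Matrix V V Rmin) :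
    (charPoly A).natDegree ≤ Fintype.card V := by
  refine Polynomial.natDegree_sum_le_of_forall_le _ _ fun σ _ => ?_
  by_cases hσ : σ = 1
  · subst hσ
    exact (monic_charPoly_diagonal_term A).2.le
  · exact (natDegree_charPoly_term hσ).le

theorem coeff_card_charPoly (A : Matrix V V Rmin) :
    (charPoly A).coeff (Fintype.card V) = 1 := by
  rw [charPoly, Matrix.permanent, Polynomial.finsetSum_coeff, Finset.sum_eq_single 1]
  · have h := monic_charPoly_diagonal_term A
    have h' := h.1.coeff_natDegree
    rw [h.2] at h'
    exact h'
  · intro σ _ hσ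
    exact Polynomial.coeff_eq_zero_of_natDegree_lt (natDegree_charPoly_term hσ)
  · simp

theorem natDegree_charPoly (A : Matrix V V Rmin) : (charPoly A).natDegree = Fintype.card V :=
  le_antisymm (natDegree_charPoly_le A)
    (Polynomial.le_natDegree_of_ne_zero (by
      rw [coeff_card_charPoly]
      exact ofReal_ne_zero 0))

theorem leadingCoeff_charPoly (A : Matrix V V Rmin) : (charPoly A).leadingCoeff = 1 := by
  rw [Polynomial.leadingCoeff, natDegree_charPoly, coeff_card_charPoly]

end CharPoly

/-! ### The sequences of roots and of critical values -/

section Sequences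

theorem prod_map_eq_prod_Icc {α M : Type*} [CommMonoid M] (c : List α) (d : α) (f : α → M) :
    (c.map f).prod = ∏ j ∈ Finset.Icc 1 c.length, f (c.getD (j - 1) d) := by
  have h : (c.map f).prod = ∏ i ∈ Finset.range c.length, f (c.getD i d) := by
    induction c with
    | nil => simp
    | cons r c ih =>
      rw [List.map_cons, List.prod_cons, List.length_cons, Finset.prod_range_succ', ih, mul_comm]
      rfl
  rw [h, Finset.range_eq_Ico]
  exact Finset.prod_Ico_add' (fun j => f (c.getD (j - 1) d)) 0 _ 1

theorem getD_flatMap_replicate {α : Type*} (m : ℕ → ℕ) (x : ℕ → α) (d : α) (k : ℕ) {ℓ i : ℕ}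
    (h1 : 1 ≤ ℓ) (hℓ : ℓ ≤ k) (hi : ∑ p ∈ Finset.Ico 1 ℓ, m p ≤ i)
    (hi' : i < ∑ p ∈ Finset.Ico 1 (ℓ + 1), m p) :
    ((List.range' 1 k).flatMap fun p => List.replicate (m p) (x p)).getD i d = x ℓ := by
  have hlen : ∀ k, ((List.range' 1 k).flatMap fun p => List.replicate (m p) (x p)).length =
      ∑ p ∈ Finset.Ico 1 (k + 1), m p := by
    intro k
    induction k with
    | zero => simp
    | succ k ih =>
      rw [List.range'_1_concat, List.flatMap_append, List.length_append, ih,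
        Finset.sum_Ico_succ_top (by omega : 1 ≤ k + 1)]
      simp [add_comm 1 k]
  induction k with
  | zero => omega
  | succ k ih =>
    rw [List.range'_1_concat, List.flatMap_append]
    rcases hℓ.lt_or_eq with h | rfl
    · rw [List.getD_append _ _ _ _ ?_]
      · exact ih (by omega)
      · rw [hlen]
        exact hi'.trans_le (Finset.sum_le_sum_of_subset
          (Finset.Ico_subset_Ico_right (by omega)))
    · rw [List.getD_append_right _ _ _ _ (by rw [hlen]; exact hi), hlen]
      rw [Finset.sum_Ico_succ_top h1] at hi'
      rw [List.flatMap_cons, List.flatMap_nil, List.append_nil, add_comm 1 k,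
        List.getD_eq_getElem _ _ (by rw [List.length_replicate]; omega), List.getElem_replicate]

theorem prod_Icc_mul_prod_Icc {M : Type*} [CommMonoid M] (f : ℕ → M) {s t : ℕ} (h : s ≤ t) :
    (∏ j ∈ Finset.Icc 1 s, f j) * ∏ j ∈ Finset.Icc (s + 1) t, f j =
      ∏ j ∈ Finset.Icc 1 t, f j :=
  Finset.prod_Ico_consecutive f (by omega : 1 ≤ s + 1) (by omega : s + 1 ≤ t + 1)

variable {V : Type*} [Fintype V] [DecidableEq V] {A : Matrix V V Rmin}

theorem eval_charPoly_eq_prod (A : Matrix V V Rmin) (y : Rmin) :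
    (charPoly A).eval y = ∏ j ∈ Finset.Icc 1 (Fintype.card V), (y + gammaSeq A j) := by
  obtain ⟨h1, -, h3⟩ := rootList_spec (charPoly A)
  rw [h3, leadingCoeff_charPoly, one_mul, prod_map_eq_prod_Icc _ 0, h1, natDegree_charPoly]
  rfl

theorem gammaSeq_mono (A : Matrix V V Rmin) {i j : ℕ} (hi : 1 ≤ i) (hij : i ≤ j) :
    gammaSeq A i ≤ gammaSeq A j := by
  obtain ⟨-, h2, -⟩ := rootList_spec (charPoly A)
  rw [gammaSeq, gammaSeq]
  by_cases hj : j - 1 < (rootList (charPoly A)).length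
  · rw [List.getD_eq_getElem _ _ hj, List.getD_eq_getElem _ _ (by omega : i - 1 < _)]
    rcases hij.lt_or_eq with h | rfl
    · exact List.pairwise_iff_getElem.1 h2 _ _ _ _ (by omega)
    · exact le_rfl
  -- Past the end of the list the default value is the semiring zero +∞, the largest element.
  · rw [List.getD_eq_default (hn := not_lt.1 hj)]
    exact Tropical.le_zero _

namespace IsCriticalData

variable {a : ℕ → ℝ} {lev : V → ℕ} {u : V → ℝ}

theorem criticalUnion_eq (D : IsCriticalData A a lev u) {ℓ : ℕ} (hℓ : ℓ ≤ numCritical A) :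
    criticalUnion A ℓ = Finset.univ.filter fun v => lev v ≤ ℓ := by
  ext v
  simp [D.mem_criticalUnion hℓ]

theorem criticalLayer_eq (D : IsCriticalData A a lev u) {ℓ : ℕ} (h1 : 1 ≤ ℓ)
    (hℓ : ℓ ≤ numCritical A) : criticalLayer A ℓ = Finset.univ.filter fun v => lev v = ℓ := by
  ext v
  simp [D.layer ℓ (Finset.mem_Icc.2 ⟨h1, hℓ⟩)]

theorem criticalUnion_succ (D : IsCriticalData A a lev u) {ℓ : ℕ} (hℓ : ℓ < numCritical A) :
    criticalUnion A (ℓ + 1) = criticalUnion A ℓ ∪ criticalLayer A (ℓ + 1) ∧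
      Disjoint (criticalUnion A ℓ) (criticalLayer A (ℓ + 1)) := by
  rw [D.criticalUnion_eq hℓ, D.criticalUnion_eq hℓ.le, D.criticalLayer_eq (by omega) hℓ]
  constructor
  · ext v
    simp only [Finset.mem_filter, Finset.mem_union, Finset.mem_univ, true_and]
    omega
  · rw [Finset.disjoint_left]
    intro v
    simp only [Finset.mem_filter, Finset.mem_univ, true_and]
    omega

theorem card_criticalUnion (D : IsCriticalData A a lev u) {ℓ : ℕ} (hℓ : ℓ ≤ numCritical A) :
    (criticalUnion A ℓ).card = ∑ m ∈ Finset.Ico 1 (ℓ + 1), (criticalLayer A m).card := by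
  induction ℓ with
  | zero => simp [criticalUnion_zero]
  | succ ℓ ih =>
    obtain ⟨h1, h2⟩ := D.criticalUnion_succ (by omega : ℓ < numCritical A)
    rw [h1, Finset.card_union_of_disjoint h2, ih (by omega),
      Finset.sum_Ico_succ_top (by omega : 1 ≤ ℓ + 1)]

theorem betaSeq_eq (D : IsCriticalData A a lev u) {ℓ : ℕ} (hℓ : ℓ < numCritical A) {j : ℕ}
    (hj : j ∈ Finset.Icc ((criticalUnion A ℓ).card + 1) (criticalUnion A (ℓ + 1)).card) :
    betaSeq A j = ofReal (a (ℓ + 1)) := by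
  rw [Finset.mem_Icc, D.card_criticalUnion hℓ.le,
    D.card_criticalUnion (show ℓ + 1 ≤ _ from hℓ)] at hj
  rw [betaSeq, criticalList, getD_flatMap_replicate _ _ _ _ (by omega : 1 ≤ ℓ + 1) hℓ
    (by omega) (by omega), D.value _ (Finset.mem_Icc.2 ⟨by omega, hℓ⟩)]

theorem prod_betaSeq (D : IsCriticalData A a lev u) {ℓ : ℕ} (hℓ : ℓ ≤ numCritical A) :
    ∏ j ∈ Finset.Icc 1 (criticalUnion A ℓ).card, betaSeq A j =
      ofReal (∑ v ∈ criticalUnion A ℓ, a (lev v)) := by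
  induction ℓ with
  | zero => simp [criticalUnion_zero, ofReal_zero]
  | succ ℓ ih =>
    obtain ⟨h1, h2⟩ := D.criticalUnion_succ (by omega : ℓ < numCritical A)
    have hcard := congrArg Finset.card h1
    rw [Finset.card_union_of_disjoint h2] at hcard
    rw [← prod_Icc_mul_prod_Icc _ (by omega : (criticalUnion A ℓ).card ≤ _), ih (by omega),
      Finset.prod_congr rfl fun j hj => D.betaSeq_eq hℓ hj, Finset.prod_const, Nat.card_Icc,
      h1, Finset.sum_union h2, ofReal_add, ofReal_pow, Finset.card_union_of_disjoint h2]
    congr 2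
    rw [Finset.sum_congr rfl fun v hv => by
      rw [(D.layer (ℓ + 1) (Finset.mem_Icc.2 ⟨by omega, hℓ⟩) v).1 hv], Finset.sum_const,
      nsmul_eq_mul]
    congr 2
    omega

theorem card_criticalUnion_lt (D : IsCriticalData A a lev u) {ℓ : ℕ} (hℓ : ℓ < numCritical A) :
    (criticalUnion A ℓ).card < (criticalUnion A (ℓ + 1)).card := by
  obtain ⟨h1, h2⟩ := D.criticalUnion_succ hℓ
  rw [h1, Finset.card_union_of_disjoint h2]
  have := (D.layer_nonempty (ℓ + 1) (Finset.mem_Icc.2 ⟨by omega, hℓ⟩)).card_pos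
  omega

end IsCriticalData

end Sequences

/-! ### Products of linear factors -/

section Roots

variable {γ : ℕ → Rmin} {n s : ℕ} {b : ℝ}

theorem prod_Icc_ofReal (s n : ℕ) (y : ℝ) :
    ∏ _j ∈ Finset.Icc (s + 1) n, ofReal y = ofReal ((n - s : ℕ) * y) := by
  rw [Finset.prod_const, Nat.card_Icc, ofReal_pow]
  congr 3
  omega

/-- Each factor is a minimum: it is bounded by the root for the first `s` indices and by `y` for the
others. -/
theorem prod_add_le (γ : ℕ → Rmin) (hs : s ≤ n) (y : ℝ) :
    ∏ j ∈ Finset.Icc 1 n, (ofReal y + γ j) ≤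
      (∏ j ∈ Finset.Icc 1 s, γ j) * ofReal ((n - s : ℕ) * y) := by
  rw [← prod_Icc_mul_prod_Icc _ hs, ← prod_Icc_ofReal]
  exact mul_le_mul' (Finset.prod_le_prod' fun j _ => add_le_right _ _)
    (Finset.prod_le_prod' fun j _ => add_le_left _ _)

theorem le_prod_roots (hs : s ≤ n) {y : ℝ}
    (h : ofReal (b + (n - s : ℕ) * y) ≤ ∏ j ∈ Finset.Icc 1 n, (ofReal y + γ j)) :
    ofReal b ≤ ∏ j ∈ Finset.Icc 1 s, γ j := by
  have := h.trans (prod_add_le γ hs y)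
  rwa [ofReal_add, mul_ofReal_le_iff] at this

/-- The real number `min(y, x)`. -/
def minReal (y : ℝ) (x : Rmin) : ℝ :=
  (exists_ofReal (ne_zero_of_le (add_le_left (ofReal y) x) (ofReal_ne_zero y))).choose

theorem ofReal_minReal (y : ℝ) (x : Rmin) : ofReal (minReal y x) = ofReal y + x :=
  (exists_ofReal
    (ne_zero_of_le (add_le_left (ofReal y) x) (ofReal_ne_zero y))).choose_spec.symm

theorem minReal_le (y : ℝ) (x : Rmin) : minReal y x ≤ y := by
  rw [← ofReal_le, ofReal_minReal]
  exact add_le_left _ _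

theorem minReal_mono {y z : ℝ} (h : y ≤ z) (x : Rmin) : minReal y x ≤ minReal z x := by
  rw [← ofReal_le, ofReal_minReal, ofReal_minReal]
  exact le_add ((add_le_left _ _).trans (ofReal_le.2 h)) (add_le_right _ _)

theorem minReal_eq {y : ℝ} {x : Rmin} (h : ofReal y ≤ x) : minReal y x = y := by
  rw [← ofReal_inj, ofReal_minReal, add_eq_of_le h]

/-- The product lies below the line of slope n - s and touches it at `α`. If `γ s` were larger than
`α`, then just after `α` all factors from the `s`-th on would still equal the variable, and the
product would rise above the line. -/
theorem root_le (hγ : ∀ i j, 1 ≤ i → i ≤ j → γ i ≤ γ j) (h1 : 1 ≤ s) (hs : s ≤ n) {α : ℝ}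
    (hle : ∀ y, ∏ j ∈ Finset.Icc 1 n, (ofReal y + γ j) ≤ ofReal (b + (n - s : ℕ) * y))
    (hα : ofReal (b + (n - s : ℕ) * α) ≤ ∏ j ∈ Finset.Icc 1 n, (ofReal α + γ j)) :
    γ s ≤ ofReal α := by
  by_contra! hlt
  obtain ⟨y, hαy, hy⟩ : ∃ y, α < y ∧ ofReal y ≤ γ s := by
    by_cases h0 : γ s = 0
    · exact ⟨α + 1, by linarith, h0 ▸ Tropical.le_zero _⟩
    · obtain ⟨y, hy⟩ := exists_ofReal h0
      exact ⟨y, ofReal_lt.1 (hy ▸ hlt), hy.ge⟩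
  have hprod : ∀ y, ∏ j ∈ Finset.Icc 1 n, (ofReal y + γ j) =
      ofReal ((∑ j ∈ Finset.Icc 1 s, minReal y (γ j)) +
        ∑ j ∈ Finset.Icc (s + 1) n, minReal y (γ j)) := by
    intro y
    rw [ofReal_add, ofReal_sum, ofReal_sum, prod_Icc_mul_prod_Icc _ hs]
    exact Finset.prod_congr rfl fun j _ => (ofReal_minReal _ _).symm
  have hcard : ∀ y : ℝ, ∑ _j ∈ Finset.Icc (s + 1) n, y = (n - s : ℕ) * y := by
    intro y
    rw [Finset.sum_const, Nat.card_Icc, nsmul_eq_mul]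
    congr 2
    omega
  have h2 : ∑ j ∈ Finset.Icc (s + 1) n, minReal y (γ j) = (n - s : ℕ) * y := by
    rw [← hcard]
    refine Finset.sum_congr rfl fun j hj => minReal_eq (hy.trans (hγ s j h1 ?_))
    have := Finset.mem_Icc.1 hj
    omega
  have h3 : ∑ j ∈ Finset.Icc (s + 1) n, minReal α (γ j) ≤ (n - s : ℕ) * α := by
    rw [← hcard]
    exact Finset.sum_le_sum fun j _ => minReal_le _ _
  have h4 := hle y
  rw [hprod, h2, ofReal_le] at h4
  rw [hprod, ofReal_le] at hα
  have h5 : ∑ j ∈ Finset.Icc 1 s, minReal α (γ j) < ∑ j ∈ Finset.Icc 1 s, minReal y (γ j) := by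
    refine Finset.sum_lt_sum (fun j _ => minReal_mono hαy.le _)
      ⟨s, Finset.mem_Icc.2 ⟨h1, le_rfl⟩, ?_⟩
    rw [minReal_eq hy]
    exact (minReal_le _ _).trans_lt hαy
  linarith

/-- Evaluate at `γ s`, finite by `root_le`: there the first `s` factors are the roots and the others
are all `γ s`. -/
theorem prod_roots_le (hγ : ∀ i j, 1 ≤ i → i ≤ j → γ i ≤ γ j) (h1 : 1 ≤ s) (hs : s ≤ n) {α : ℝ}
    (hle : ∀ y, ∏ j ∈ Finset.Icc 1 n, (ofReal y + γ j) ≤ ofReal (b + (n - s : ℕ) * y))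
    (hα : ofReal (b + (n - s : ℕ) * α) ≤ ∏ j ∈ Finset.Icc 1 n, (ofReal α + γ j)) :
    ∏ j ∈ Finset.Icc 1 s, γ j ≤ ofReal b := by
  obtain ⟨g, hg⟩ := exists_ofReal
    (ne_zero_of_le (root_le hγ h1 hs hle hα) (ofReal_ne_zero α))
  have h := hle g
  rw [← prod_Icc_mul_prod_Icc _ hs, ofReal_add, ← prod_Icc_ofReal] at h
  have e1 : ∏ j ∈ Finset.Icc 1 s, (ofReal g + γ j) = ∏ j ∈ Finset.Icc 1 s, γ j := by
    refine Finset.prod_congr rfl fun j hj => ?_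
    have := Finset.mem_Icc.1 hj
    rw [add_comm, add_eq_of_le (hg ▸ hγ j s this.1 this.2)]
  have e2 : ∏ j ∈ Finset.Icc (s + 1) n, (ofReal g + γ j) =
      ∏ _j ∈ Finset.Icc (s + 1) n, ofReal g := by
    refine Finset.prod_congr rfl fun j hj => ?_
    have := Finset.mem_Icc.1 hj
    rw [add_eq_of_le (hg ▸ hγ s j h1 (by omega))]
  rwa [e1, e2, prod_Icc_ofReal, mul_ofReal_le_iff] at h

/-- Bounding the value at `α` by s - 1 roots and n - s + 1 copies of `α` leaves exactly this
comparison. -/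
theorem root_le_of_prod_eq (h1 : 1 ≤ s) (hs : s ≤ n) {α : ℝ}
    (hb : ∏ j ∈ Finset.Icc 1 s, γ j = ofReal b)
    (hα : ofReal (b + (n - s : ℕ) * α) ≤ ∏ j ∈ Finset.Icc 1 n, (ofReal α + γ j)) :
    γ s ≤ ofReal α := by
  obtain ⟨t, rfl⟩ : ∃ t, s = t + 1 := ⟨s - 1, by omega⟩
  have h := hα.trans (prod_add_le γ (by omega : t ≤ n) α)
  rw [Finset.prod_Icc_succ_top (by omega)] at hb
  have hne : (∏ j ∈ Finset.Icc 1 t, γ j) * γ (t + 1) ≠ 0 := hb ▸ ofReal_ne_zero b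
  obtain ⟨d, hd⟩ := exists_ofReal (left_ne_zero_of_mul hne)
  obtain ⟨g, hg⟩ := exists_ofReal (right_ne_zero_of_mul hne)
  rw [hd, hg, ← ofReal_add, ofReal_inj] at hb
  rw [hd, ← ofReal_add, ofReal_le, show n - t = n - (t + 1) + 1 by omega] at h
  push_cast at h
  rw [hg, ofReal_le]
  linarith

/-- Here the value at `α` is bounded by one root more, s + 1 of them, and one copy of `α` fewer. -/
theorem le_root_of_prod_eq (hs : s < n) {α : ℝ}
    (hb : ∏ j ∈ Finset.Icc 1 s, γ j = ofReal b)
    (hα : ofReal (b + (n - s : ℕ) * α) ≤ ∏ j ∈ Finset.Icc 1 n, (ofReal α + γ j)) :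
    ofReal α ≤ γ (s + 1) := by
  have h := hα.trans (prod_add_le γ (by omega : s + 1 ≤ n) α)
  rw [Finset.prod_Icc_succ_top (by omega), hb] at h
  by_cases h0 : γ (s + 1) = 0
  · rw [h0]
    exact Tropical.le_zero _
  obtain ⟨g, hg⟩ := exists_ofReal h0
  rw [hg, ← ofReal_add, ← ofReal_add, ofReal_le, show n - s = n - (s + 1) + 1 by omega] at h
  push_cast at h
  rw [hg, ofReal_le]
  linarith

end Roots

/-! ### Values of the characteristic polynomial -/

section Main

variable {V : Type*} [DecidableEq V] {A : Matrix V V Rmin} {a : ℕ → ℝ} {lev : V → ℕ} {u : V → ℝ}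

/-- On a loop the potential cancels, so the added diagonal only asks that the node weight be at most
`y`. -/
theorem IsPotential.diagonal_add {w : V → ℝ} (hu : IsPotential A w u) (y : ℝ) :
    IsPotential (Matrix.diagonal (fun _ : V => ofReal y) + A) (fun v => min y (w v)) u := by
  refine isPotential_iff.2 fun i j => ?_
  rw [Matrix.add_apply, Matrix.diagonal_apply]
  refine le_add ?_ ((ofReal_le.2 ?_).trans (isPotential_iff.1 hu i j))
  · split_ifs with h
    · subst h
      rw [ofReal_le, add_sub_cancel_right]
      exact min_le_left _ _
    · exact Tropical.le_zero _
  · linarith [min_le_right y (w i)]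

variable [Fintype V]

namespace IsCriticalData

theorem le_eval_charPoly (D : IsCriticalData A a lev u) (y : ℝ) :
    ofReal (∑ v, min y (a (lev v))) ≤ (charPoly A).eval (ofReal y) := by
  rw [eval_charPoly]
  exact le_sum fun τ _ => (D.potential.diagonal_add y).le_prod id τ
    (Equiv.sum_comp τ u).symm

theorem card_compl_criticalUnion (A : Matrix V V Rmin) (ℓ : ℕ) :
    ((criticalUnion A ℓ)ᶜ.card : ℝ) = (Fintype.card V - (criticalUnion A ℓ).card : ℕ) := by
  rw [Finset.card_compl]

theorem sum_min (D : IsCriticalData A a lev u) {ℓ : ℕ} (hℓ : ℓ ≤ numCritical A) {y : ℝ}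
    (h1 : ∀ v, lev v ≤ ℓ → a (lev v) ≤ y) (h2 : ∀ v, ℓ < lev v → y ≤ a (lev v)) :
    ∑ v, min y (a (lev v)) = ∑ v ∈ criticalUnion A ℓ, a (lev v) +
      (Fintype.card V - (criticalUnion A ℓ).card : ℕ) * y := by
  rw [← Finset.sum_add_sum_compl (criticalUnion A ℓ), ← card_compl_criticalUnion, ← nsmul_eq_mul,
    ← Finset.sum_const]
  congr 1
  · refine Finset.sum_congr rfl fun v hv => min_eq_right (h1 v ?_)
    rwa [D.mem_criticalUnion hℓ] at hv
  · refine Finset.sum_congr rfl fun v hv => min_eq_left (h2 v ?_)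
    rwa [Finset.mem_compl, D.mem_criticalUnion hℓ, not_le] at hv

theorem le_eval_charPoly_of_le (D : IsCriticalData A a lev u) {ℓ : ℕ} (hℓ : ℓ ≤ numCritical A)
    {y : ℝ} (h1 : ∀ v, lev v ≤ ℓ → a (lev v) ≤ y) (h2 : ∀ v, ℓ < lev v → y ≤ a (lev v)) :
    ofReal (∑ v ∈ criticalUnion A ℓ, a (lev v) +
      (Fintype.card V - (criticalUnion A ℓ).card : ℕ) * y) ≤
        ∏ j ∈ Finset.Icc 1 (Fintype.card V), (ofReal y + gammaSeq A j) := by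
  rw [← D.sum_min hℓ h1 h2, ← eval_charPoly_eq_prod]
  exact D.le_eval_charPoly y

/-- The term of `τ` alone suffices: take `A` on C^ℓ, where the arcs are tight, and the diagonal `y`
on the fixed nodes. -/
theorem eval_charPoly_le_of_perm (D : IsCriticalData A a lev u) {ℓ : ℕ}
    (hℓ : ℓ ≤ numCritical A) {τ : Equiv.Perm V} (h1 : ∀ i, ℓ < lev i → τ i = i)
    (h2 : ∀ i, lev i ≤ ℓ → Tight A (fun v => a (lev v)) u i (τ i)) (y : ℝ) :
    (charPoly A).eval (ofReal y) ≤ ofReal (∑ v ∈ criticalUnion A ℓ, a (lev v) +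
      (Fintype.card V - (criticalUnion A ℓ).card : ℕ) * y) := by
  set w : V → ℝ := fun v => if lev v ≤ ℓ then a (lev v) else y with hw
  have hsum : ∑ v ∈ criticalUnion A ℓ, a (lev v) +
      (Fintype.card V - (criticalUnion A ℓ).card : ℕ) * y = ∑ v, (w v + u v - u (τ v)) := by
    rw [Finset.sum_sub_distrib, Finset.sum_add_distrib, Equiv.sum_comp τ u,
      add_sub_cancel_right, ← Finset.sum_add_sum_compl (criticalUnion A ℓ),
      ← card_compl_criticalUnion, ← nsmul_eq_mul, ← Finset.sum_const]
    congr 1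
    · refine Finset.sum_congr rfl fun v hv => (if_pos ?_).symm
      rwa [D.mem_criticalUnion hℓ] at hv
    · refine Finset.sum_congr rfl fun v hv => (if_neg ?_).symm
      rwa [Finset.mem_compl, D.mem_criticalUnion hℓ] at hv
  rw [hsum, eval_charPoly, ofReal_sum]
  refine (sum_le (Finset.mem_univ τ)).trans (Finset.prod_le_prod' fun i _ => ?_)
  rw [Matrix.add_apply]
  by_cases hi : lev i ≤ ℓ
  · refine (add_le_right _ _).trans ((tight_iff.1 (h2 i hi)).le.trans (ofReal_le.2 ?_))
    simp [hw, hi]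
  · refine (add_le_left _ _).trans ?_
    rw [h1 i (not_le.1 hi), Matrix.diagonal_apply_eq, ofReal_le]
    simp [hw, hi]

/-- A permutation attaining the permanent uses only tight arcs of `y I ⊕ A`. The strict inequalities
on `y` decide their origin: beyond layer ℓ an arc of `A` is too heavy, and up to layer ℓ the
diagonal `y` is. -/
theorem exists_perm_of_eval_charPoly_le (D : IsCriticalData A a lev u) {ℓ : ℕ} {y : ℝ}
    (h1 : ∀ v, lev v ≤ ℓ → a (lev v) < y) (h2 : ∀ v, ℓ < lev v → y < a (lev v))
    (h : (charPoly A).eval (ofReal y) ≤ ofReal (∑ v, min y (a (lev v)))) :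
    ∃ τ : Equiv.Perm V, (∀ i, ℓ < lev i → τ i = i) ∧
      ∀ i, lev i ≤ ℓ → Tight A (fun v => a (lev v)) u i (τ i) := by
  rw [eval_charPoly] at h
  obtain ⟨τ, -, hτ⟩ := exists_sum_eq Finset.univ_nonempty fun τ : Equiv.Perm V =>
    ∏ i, (Matrix.diagonal (fun _ : V => ofReal y) + A) i (τ i)
  rw [hτ] at h
  have ht : ∀ i, (Matrix.diagonal (fun _ : V => ofReal y) + A) i (τ i) =
      ofReal (min y (a (lev i)) + u i - u (τ i)) := fun i =>
    tight_iff.1 ((D.potential.diagonal_add y).tight_of_prod_le id τ (Equiv.sum_comp τ u).symm h i)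
  refine ⟨τ, fun i hi => ?_, fun i hi => ?_⟩
  · by_contra hne
    have h3 := ht i
    rw [Matrix.add_apply, Matrix.diagonal_apply_ne _ (Ne.symm hne), zero_add,
      min_eq_left (h2 i hi).le] at h3
    have h4 := isPotential_iff.1 D.potential i (τ i)
    rw [h3, ofReal_le] at h4
    linarith [h2 i hi]
  · refine tight_iff.2 ?_
    have h3 := ht i
    rw [min_eq_right (h1 i hi).le, Matrix.add_apply] at h3
    rcases add_eq_or (Matrix.diagonal (fun _ : V => ofReal y) i (τ i)) (A i (τ i)) with h4 | h4
    · rw [h4, Matrix.diagonal_apply] at h3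
      split_ifs at h3 with h5
      · rw [← h5, ofReal_inj] at h3
        linarith [h1 i hi]
      · exact absurd h3.symm (ofReal_ne_zero _)
    · rw [← h4, h3]

/-- The critical graph of order `ℓ` has a disjoint circuit cover if and only if the product of the
first `|C^ℓ|` roots is the product of the critical values of the nodes of `C^ℓ`. -/
theorem hasDisjointCircuitCover_iff_prod (D : IsCriticalData A a lev u) {ℓ : ℕ}
    (hℓ : ℓ ≤ numCritical A) :
    HasDisjointCircuitCover (criticalGraph A ℓ) ↔
      ∏ j ∈ Finset.Icc 1 (criticalUnion A ℓ).card, gammaSeq A j =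
        ∏ j ∈ Finset.Icc 1 (criticalUnion A ℓ).card, betaSeq A j := by
  rw [D.prod_betaSeq hℓ]
  rcases Nat.eq_zero_or_pos ℓ with rfl | h1
  · refine iff_of_true ?_ (by simp [criticalUnion_zero, ofReal_zero])
    rw [criticalGraph, if_pos rfl]
    exact ⟨∅, by simp [emptyGraph]⟩
  rw [D.hasDisjointCircuitCover_iff hℓ]
  have hs : (criticalUnion A ℓ).card ≤ Fintype.card V := Finset.card_le_univ _
  have hs1 : 1 ≤ (criticalUnion A ℓ).card := by
    have := D.card_criticalUnion_lt (show ℓ - 1 < numCritical A by omega)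
    rw [Nat.sub_add_cancel h1] at this
    omega
  constructor
  · rintro ⟨τ, hτ, hτ'⟩
    -- The permutation gives an affine upper bound for all `y`, and the potential gives the same
    -- affine expression as a lower bound at `a ℓ`.
    have hle := fun y => (eval_charPoly_eq_prod A (ofReal y)).ge.trans
      (D.eval_charPoly_le_of_perm hℓ hτ hτ' y)
    have hα := D.le_eval_charPoly_of_le hℓ (fun v hv => D.value_le (D.one_le_lev v) hv hℓ)
      fun v hv => (D.value_lt h1 hv (D.lev_le v)).le
    exact le_antisymm
      (prod_roots_le (fun _ _ => gammaSeq_mono A) hs1 hs hle hα) (le_prod_roots hs hα)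
  · intro h
    -- Any `y` strictly between two consecutive critical values, or above the last one, separates
    -- the layers.
    obtain ⟨y, hy1, hy2⟩ : ∃ y, (∀ v, lev v ≤ ℓ → a (lev v) < y) ∧
        ∀ v, ℓ < lev v → y < a (lev v) := by
      rcases hℓ.lt_or_eq with hlt | heq
      · obtain ⟨y, h3, h4⟩ := exists_between (D.lt_succ ℓ h1 hlt)
        exact ⟨y, fun v hv => (D.value_le (D.one_le_lev v) hv hℓ).trans_lt h3,
          fun v hv => h4.trans_le (D.value_le (by omega) hv (D.lev_le v))⟩
      · refine ⟨a ℓ + 1, fun v hv => ?_, fun v hv => ?_⟩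
        · have := D.value_le (D.one_le_lev v) hv hℓ
          linarith
        · have := D.lev_le v
          omega
    refine D.exists_perm_of_eval_charPoly_le hy1 hy2 ?_
    rw [D.sum_min hℓ (fun v hv => (hy1 v hv).le) (fun v hv => (hy2 v hv).le),
      eval_charPoly_eq_prod, ofReal_add, ← h]
    exact prod_add_le _ hs y

/-- If the products of the first `|C^{ℓ}|` and `|C^{ℓ+1}|` roots are the products of the
corresponding critical values, then the roots in between are equal to the critical value. -/
theorem gammaSeq_eq (D : IsCriticalData A a lev u) {ℓ : ℕ} (hℓ : ℓ < numCritical A)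
    (h1 : ∏ j ∈ Finset.Icc 1 (criticalUnion A ℓ).card, gammaSeq A j =
      ∏ j ∈ Finset.Icc 1 (criticalUnion A ℓ).card, betaSeq A j)
    (h2 : ∏ j ∈ Finset.Icc 1 (criticalUnion A (ℓ + 1)).card, gammaSeq A j =
      ∏ j ∈ Finset.Icc 1 (criticalUnion A (ℓ + 1)).card, betaSeq A j) {j : ℕ}
    (hj : j ∈ Finset.Icc ((criticalUnion A ℓ).card + 1) (criticalUnion A (ℓ + 1)).card) :
    gammaSeq A j = betaSeq A j := by
  rw [D.betaSeq_eq hℓ hj]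
  rw [D.prod_betaSeq hℓ.le] at h1
  rw [D.prod_betaSeq hℓ] at h2
  have hs := D.card_criticalUnion_lt hℓ
  have hs' : (criticalUnion A (ℓ + 1)).card ≤ Fintype.card V := Finset.card_le_univ _
  -- The value `a (ℓ + 1)` weakly separates the layers both after ℓ and after ℓ + 1. It therefore
  -- bounds the last root of the block from above and the first from below, and monotonicity settles
  -- the block.
  have hle := root_le_of_prod_eq (by omega) hs' h2 (D.le_eval_charPoly_of_le hℓ
    (fun v hv => D.value_le (D.one_le_lev v) hv hℓ)
    fun v hv => (D.value_lt (by omega) hv (D.lev_le v)).le)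
  have hge := le_root_of_prod_eq (by omega) h1 (D.le_eval_charPoly_of_le hℓ.le
    (fun v hv => D.value_le (D.one_le_lev v) (by omega : lev v ≤ ℓ + 1) hℓ)
    fun v hv => D.value_le (by omega) hv (D.lev_le v))
  have hj := Finset.mem_Icc.1 hj
  exact le_antisymm ((gammaSeq_mono A (by omega) hj.2).trans hle)
    (hge.trans (gammaSeq_mono A (by omega) hj.1))

end IsCriticalData

end Main

end MinPlus

end

theorem mainTheorem4 (n : ℕ) (A : Matrix (Fin n) (Fin n) MinPlus.Rmin)
    (hA : MinPlus.IsIrreducible A) (ℓ : ℕ) (hℓ : ℓ ∈ Finset.Icc 1 (MinPlus.numCritical A)) :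
    ((∀ j ∈ Finset.Icc ((MinPlus.criticalUnion A (ℓ - 1)).card + 1)
          (MinPlus.criticalUnion A ℓ).card,
        MinPlus.gammaSeq A j = MinPlus.betaSeq A j) ∧
      ∏ j ∈ Finset.Icc 1 (MinPlus.criticalUnion A (ℓ - 1)).card, MinPlus.gammaSeq A j =
        ∏ j ∈ Finset.Icc 1 (MinPlus.criticalUnion A (ℓ - 1)).card, MinPlus.betaSeq A j) ↔
    (MinPlus.HasDisjointCircuitCover (MinPlus.criticalGraph A (ℓ - 1)) ∧
      MinPlus.HasDisjointCircuitCover (MinPlus.criticalGraph A ℓ)) := by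
  obtain ⟨h1, h2⟩ := Finset.mem_Icc.1 hℓ
  obtain ⟨m, rfl⟩ : ∃ m, ℓ = m + 1 := ⟨ℓ - 1, by omega⟩
  obtain ⟨a, lev, u, D⟩ := MinPlus.exists_isCriticalData hA (h1.trans h2)
  have hm : m < MinPlus.numCritical A := h2
  rw [Nat.add_sub_cancel, D.hasDisjointCircuitCover_iff_prod hm.le,
    D.hasDisjointCircuitCover_iff_prod h2]
  constructor
  · rintro ⟨h3, h4⟩
    refine ⟨h4, ?_⟩
    -- The product up to |C^ℓ| is the product up to |C^{ℓ-1}| times the block of the layer, and both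
    -- parts agree.
    rw [← MinPlus.prod_Icc_mul_prod_Icc (MinPlus.gammaSeq A) (D.card_criticalUnion_lt hm).le, h4,
      Finset.prod_congr rfl h3, MinPlus.prod_Icc_mul_prod_Icc _ (D.card_criticalUnion_lt hm).le]
  · rintro ⟨h3, h4⟩
    exact ⟨fun j hj => D.gammaSeq_eq hm h3 h4 hj, h3⟩
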